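/- Let $\kappa$ be an uncountable regular cardinal with $2^{<\kappa}=\kappa$. *Definitions.* A $\kappa^+$-algebra on a set $X$ is a family of subsets of $X$ closed under complements and under unions of at most $\kappa$ many members. For a topology $\tau$ on $X$, $\mathsf{Bor}_\kappa(X,\tau)$ is the smallest $\kappa^+$-algebra on $X$ containing $\tau$; its members are the $\kappa$-Borel sets of $(X,\tau)$. A $\kappa$-Borel space is a pair $(X,\mathscr B)$ where $\mathscr B$ is a $\kappa^+$-algebra on $X$ that separates points and is generated, as a $\kappa^+$-algebra, by at most $\kappa$ many sets. The space ${}^\kappa\kappa$ of all functions from $\kappa$ to $\kappa$ carries the bounded topology, generated by the sets $\{x\in{}^\kappa\kappa\mid s\subseteq x\}$ for $s\in{}^{<\kappa}\kappa$. A $\kappa$-Borel space $(X,\mathscr B)$ is *standard* if there are a $\kappa$-Borel set $D\subseteq{}^\kappa\kappa$ and a bijection $f\colon X\to D$ such that, for $\mathscr B_D=\{A\cap D\mid A\in\mathsf{Bor}_\kappa({}^\kappa\kappa)\}$, one has $f^{-1}(A)\in\mathscr B$ for all $A\in\mathscr B_D$ and $f(A)\in\mathscr B_D$ for all $A\in\mathscr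 B$. A topology is $\kappa$-additive if it is closed under intersections of fewer than $\kappa$ many open sets. In the strong $\kappa$-Choquet game on a topological space $X$, in round $\alpha<\kappa$ player $\mathrm{I}$ plays a pair $(U_\alpha,x_\alpha)$ with $x_\alpha\in U_\alpha$, and then player $\mathrm{II}$ plays $V_\alpha$ with $x_\alpha\in V_\alpha\subseteq U_\alpha$; both $U_\alpha$ and $V_\alpha$ must be relatively open subsets of $\bigcap_{\beta<\alpha}V_\beta$ (which is $X$ for $\alpha=0$). Player $\mathrm{II}$ wins if $\bigcap_{\beta<\gamma}V_\beta\neq\emptyset$ for every limit ordinal $0<\gamma\le\kappa$ (if this fails for some limit $\gamma<\kappa$, the run stops there and $\mathrm{I}$ wins). The strong fair $\kappa$-Choquet game has the same moves, but $\mathrm{II}$ wins if $\bigcap_{\beta<\kappa}V_\beta\ne\emptyset$ or if $\bigcap_{\beta<\gamma}V_\beta=\emptyset$ for some limit $0<\gamma<\kappa$. An $\mathrm{SC}_\kappa$-space (respectively, an $f\mathrm{SC}_\kappa$-space) is a regular Hausdorff topological space of weight $\le\kappa$ in which player $\mathrm{II}$ has a winning strategy in the strong (respectively, strong fair) $\kappa$-Choquet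 game. **Theorem.** Let $(X,\mathscr B)$ be a $\kappa$-Borel space. The following are equivalent: 1. $(X,\mathscr B)$ is standard; 2. there is a topology $\tau$ on $X$ such that $(X,\tau)$ is an $f\mathrm{SC}_\kappa$-space and $\mathsf{Bor}_\kappa(X,\tau)=\mathscr B$; 3. there is a topology $\tau$ on $X$ such that $(X,\tau)$ is a $\kappa$-additive $\mathrm{SC}_\kappa$-space and $\mathsf{Bor}_\kappa(X,\tau)=\mathscr B$. -/

import Mathlib

open Cardinal Topology

universe u

namespace GDST

/-! ### `κ`-Borel spaces -/

/-- A `κ⁺`-algebra on `X`: a family of subsets closed under complements and under unions of at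
most `κ` many members. -/
structure IsKappaAlgebra (κ : Cardinal.{u}) {X : Type u} (B : Set (Set X)) : Prop where
  compl_mem : ∀ A ∈ B, Aᶜ ∈ B
  sUnion_mem : ∀ C : Set (Set X), C ⊆ B → #C ≤ κ → ⋃₀ C ∈ B

/-- The smallest `κ⁺`-algebra on `X` containing the family `G`. -/
def generatedAlgebra (κ : Cardinal.{u}) {X : Type u} (G : Set (Set X)) : Set (Set X) :=
  ⋂₀ {B : Set (Set X) | IsKappaAlgebra κ B ∧ G ⊆ B}

/-- The `κ⁺`-algebra of the `κ`-Borel subsets of a topological space. -/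
def Bor (κ : Cardinal.{u}) {X : Type u} (τ : TopologicalSpace X) : Set (Set X) :=
  generatedAlgebra κ {U : Set X | IsOpen[τ] U}

/-- `(X, B)` is a `κ`-Borel space: `B` is a `κ⁺`-algebra which separates points and is generated
(as a `κ⁺`-algebra) by at most `κ` many sets. -/
structure IsKappaBorelSpace (κ : Cardinal.{u}) {X : Type u} (B : Set (Set X)) : Prop where
  isKappaAlgebra : IsKappaAlgebra κ B
  separates : ∀ x y : X, x ≠ y → ∃ A ∈ B, x ∈ A ∧ y ∉ A
  exists_basis : ∃ G : Set (Set X), #G ≤ κ ∧ generatedAlgebra κ G = B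

/-- The structure induced by `B` on a subset `Y`, i.e. all sets `A ∩ Y` with `A ∈ B`. -/
def restrict {X : Type u} (B : Set (Set X)) (Y : Set X) : Set (Set Y) :=
  {A : Set Y | ∃ S ∈ B, A = Subtype.val ⁻¹' S}

/-- `f` is measurable with respect to the families `B` and `B'`. -/
def IsBorelMap {X Y : Type u} (B : Set (Set X)) (B' : Set (Set Y)) (f : X → Y) : Prop :=
  ∀ A ∈ B', f ⁻¹' A ∈ B

/-- There is a bijection which is measurable in both directions. -/
def BorelIsomorphic {X Y : Type u} (B : Set (Set X)) (B' : Set (Set Y)) : Prop :=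
  ∃ f : X ≃ Y, IsBorelMap B B' f ∧ IsBorelMap B' B f.symm

/-- The underlying set of the generalized Baire space: all functions from `κ` to `κ`. -/
abbrev Baire (κ : Cardinal.{u}) : Type u := κ.ord.ToType → κ.ord.ToType

/-- The bounded topology on the generalized Baire space, generated by the sets of all extensions
of a sequence `s` of length `α < κ`. -/
@[reducible] def boundedTopology (κ : Cardinal.{u}) : TopologicalSpace (Baire κ) :=
  TopologicalSpace.generateFrom
    {N : Set (Baire κ) | ∃ (α : κ.ord.ToType) (s : Set.Iio α → κ.ord.ToType),
      N = {x | ∀ β : Set.Iio α, x β = s β}}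

/-- `(X, B)` is isomorphic to a `κ`-Borel subset of the generalized Baire space. -/
def IsStandard (κ : Cardinal.{u}) {X : Type u} (B : Set (Set X)) : Prop :=
  ∃ D ∈ Bor κ (boundedTopology κ), BorelIsomorphic B (restrict (Bor κ (boundedTopology κ)) D)

/-! ### Topological notions -/

/-- The topology `τ` has a basis with at most `κ` many elements. -/
def WeightLE (κ : Cardinal.{u}) {X : Type u} (τ : TopologicalSpace X) : Prop :=
  ∃ b : Set (Set X), #b ≤ κ ∧ @TopologicalSpace.IsTopologicalBasis X τ b

/-- The topology `τ` is closed under intersections of fewer than `κ` many open sets. -/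
def IsAdditive (κ : Cardinal.{u}) {X : Type u} (τ : TopologicalSpace X) : Prop :=
  ∀ C : Set (Set X), (∀ U ∈ C, IsOpen[τ] U) → #C < κ → IsOpen[τ] (⋂₀ C)

/-- `U` is a relatively open subset of `S`. -/
def RelOpen {X : Type u} (τ : TopologicalSpace X) (S U : Set X) : Prop :=
  ∃ O : Set X, IsOpen[τ] O ∧ U = O ∩ S

/-! ### Choquet games of length `κ`

In round `α < κ`, player I plays a set together with a point of it, and player II answers with a
smaller set still containing that point. Both sets are open relatively to the intersection of
all sets played in the previous rounds (the whole space in round `0`). -/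

/-- A sequence of moves of player I. Of a partial run of length `γ`, only the moves with index
below `γ` are relevant. -/
abbrev Moves (κ : Cardinal.{u}) (X : Type u) : Type u := κ.ord.ToType → Set X × X

/-- A strategy for player II: it gives the answer in round `α` as a function of the moves of
player I in the rounds up to and including `α`. -/
abbrev Strategy (κ : Cardinal.{u}) (X : Type u) : Type u :=
  (α : κ.ord.ToType) → (Set.Iic α → Set X × X) → Set X

/-- The answer of player II in round `α` when following `σ` against the moves `p`. -/
def reply {κ : Cardinal.{u}} {X : Type u} (σ : Strategy κ X) (p : Moves κ X)
    (α : κ.ord.ToType) : Set X :=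
  σ α (fun β => p β)

/-- What is left when round `γ` starts: the intersection of the sets played before (it does not
matter whether the sets of player I or those of player II are intersected with what was left
earlier, since the sets decrease). -/
def before {κ : Cardinal.{u}} {X : Type u} (σ : Strategy κ X) (p : Moves κ X)
    (γ : κ.ord.ToType) : Set X :=
  ⋂ β ∈ Set.Iio γ, reply σ p β

/-- The move of player I in round `α` obeys the rules. -/
def LegalI {κ : Cardinal.{u}} {X : Type u} (τ : TopologicalSpace X) (σ : Strategy κ X)
    (p : Moves κ X) (α : κ.ord.ToType) : Prop :=
  (p α).2 ∈ (p α).1 ∧ RelOpen τ (before σ p α) (p α).1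

/-- The answer of player II in round `α` obeys the rules. -/
def LegalII {κ : Cardinal.{u}} {X : Type u} (τ : TopologicalSpace X) (σ : Strategy κ X)
    (p : Moves κ X) (α : κ.ord.ToType) : Prop :=
  (p α).2 ∈ reply σ p α ∧ reply σ p α ⊆ (p α).1 ∧
    RelOpen τ (before σ p α) (reply σ p α)

/-- `σ` is winning for player II in the strong fair `κ`-Choquet game: player II always answers
legally, and the final intersection of every run of length `κ` is nonempty. (A run that breaks
down at some limit round `γ < κ` because nothing is left is won by player II.) -/
def WinningFair {κ : Cardinal.{u}} {X : Type u} (τ : TopologicalSpace X)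
    (σ : Strategy κ X) : Prop :=
  ∀ p : Moves κ X,
    (∀ α, (∀ β ≤ α, LegalI τ σ p β) → LegalII τ σ p α) ∧
    ((∀ α, LegalI τ σ p α) → (⋂ α, reply σ p α).Nonempty)

/-- `σ` is winning for player II in the strong `κ`-Choquet game: moreover, for every limit
`γ < κ`, the intersection of the sets played in the rounds before `γ` is nonempty. -/
def WinningStrong {κ : Cardinal.{u}} {X : Type u} (τ : TopologicalSpace X)
    (σ : Strategy κ X) : Prop :=
  ∀ p : Moves κ X,
    (∀ α, (∀ β ≤ α, LegalI τ σ p β) → LegalII τ σ p α) ∧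
    (∀ γ, Order.IsSuccLimit γ → (∀ β < γ, LegalI τ σ p β) → (before σ p γ).Nonempty) ∧
    ((∀ α, LegalI τ σ p α) → (⋂ α, reply σ p α).Nonempty)

/-- `(X, τ)` is an `fSC_κ`-space: regular Hausdorff, of weight at most `κ`, and player II has a
winning strategy in the strong fair `κ`-Choquet game. -/
structure IsFSC (κ : Cardinal.{u}) {X : Type u} (τ : TopologicalSpace X) : Prop where
  t3Space : @T3Space X τ
  weightLE : WeightLE κ τ
  exists_winning : ∃ σ : Strategy κ X, WinningFair τ σ

/-- `(X, τ)` is an `SC_κ`-space: regular Hausdorff, of weight at most `κ`, and player II has a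
winning strategy in the strong `κ`-Choquet game. -/
structure IsSC (κ : Cardinal.{u}) {X : Type u} (τ : TopologicalSpace X) : Prop where
  t3Space : @T3Space X τ
  weightLE : WeightLE κ τ
  exists_winning : ∃ σ : Strategy κ X, WinningStrong τ σ

end GDST

/-!
An additive `SC_κ`-space is in particular an `fSC_κ`-space (`IsSC.isFSC`), so two implications carry
the proof: the `κ`-Borel sets of an `fSC_κ`-space, additive or not, form a standard space, and every
standard space arises from an additive `SC_κ`-space.

*From the fair game to a standard space* (`isStandard_of_isFSC`). A winning strategy of player II
is unfolded into a tree of sets `W y α`, for `y` in the Baire space and `α < κ`, depending only on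
the values of `y` up to `α` (`exists_isScheme`). These are the answers of player II; in round `α`
the moves of player I are chosen from `κ` many moves such that the corresponding answers cover what
is left, which is possible since the weight is at most `κ`. Letting player I play, in round `α`, so
as to decide the `α`-th pair of basic open sets, regularity ensures that the sets along a branch
shrink to a single point (`exists_shrinks`). A point `x` is coded by the branch which always chooses
the first node containing `x`. The codes form a `κ`-Borel set because the map from branches to
points is `κ`-Borel (`branchesOf_mem_bor`, `codes_mem_bor`); there are only `κ` many nodes as
`2 ^< κ = κ` and `κ` is regular.

*From a standard space to the strong game* (`IsStandard.exists_isSC`). By induction on `κ`-Borel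
sets `A`, the points of the Baire space can be recorded together with witnesses for the membership
in `A` so that one obtains a closed set in which `A` is decided by one coordinate
(`isPresentable_of_mem_bor`). Therefore a standard space `X` is isomorphic to a closed subset `C` of
the Baire space (`IsStandard.exists_closed_embedding`). Player II may fail to win the strong game on
`C` because of sequences of limit length which have no continuation in `C` although their proper
initial segments do. Adding one continuation of each of them turns `C` into a superclosed set
(`isSuperclosed_hull`), and adds at most `κ` many points. If `X` has at least `κ` many points, these
are absorbed by moving `κ` many points, which does not change the algebra; otherwise every subset of
`X` is in the algebra, and the points can be coded by constant sequences
(`exists_superclosed_embedding`). In a superclosed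
set, which inherits additivity and regularity from the Baire space, player II wins by answering with
basic open sets (`exists_winningStrong`).
-/

namespace GDST

/-! ### Calculus of `κ⁺`-algebras -/

section Algebra

variable {κ : Cardinal.{u}} {X Y : Type u} {B : Set (Set X)}

theorem isKappaAlgebra_generatedAlgebra (G : Set (Set X)) :
    IsKappaAlgebra κ (generatedAlgebra κ G) where
  compl_mem A hA B hB := hB.1.compl_mem A (hA B hB)
  sUnion_mem C hC hκ B hB := hB.1.sUnion_mem C (fun _ hA => hC hA B hB) hκ

theorem subset_generatedAlgebra (G : Set (Set X)) : G ⊆ generatedAlgebra κ G :=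
  fun _ hA _ hB => hB.2 hA

theorem generatedAlgebra_subset {G : Set (Set X)} (hB : IsKappaAlgebra κ B) (h : G ⊆ B) :
    generatedAlgebra κ G ⊆ B :=
  fun _ hA => hA B ⟨hB, h⟩

namespace IsKappaAlgebra

theorem iUnion_mem (hB : IsKappaAlgebra κ B) {ι : Type u} (hι : #ι ≤ κ) {f : ι → Set X}
    (hf : ∀ i, f i ∈ B) : ⋃ i, f i ∈ B := by
  rw [← Set.sUnion_range]
  exact hB.sUnion_mem _ (Set.range_subset_iff.2 hf) (mk_range_le.trans hι)

theorem iInter_mem (hB : IsKappaAlgebra κ B) {ι : Type u} (hι : #ι ≤ κ) {f : ι → Set X}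
    (hf : ∀ i, f i ∈ B) : ⋂ i, f i ∈ B := by
  rw [← compl_compl (⋂ i, f i), Set.compl_iInter]
  exact hB.compl_mem _ (hB.iUnion_mem hι fun i => hB.compl_mem _ (hf i))

theorem biUnion_mem (hB : IsKappaAlgebra κ B) {ι : Type u} {s : Set ι} (hs : #s ≤ κ)
    {f : ι → Set X} (hf : ∀ i ∈ s, f i ∈ B) : ⋃ i ∈ s, f i ∈ B := by
  rw [Set.biUnion_eq_iUnion]
  exact hB.iUnion_mem hs fun i => hf i i.2

theorem biInter_mem (hB : IsKappaAlgebra κ B) {ι : Type u} {s : Set ι} (hs : #s ≤ κ)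
    {f : ι → Set X} (hf : ∀ i ∈ s, f i ∈ B) : ⋂ i ∈ s, f i ∈ B := by
  rw [Set.biInter_eq_iInter]
  exact hB.iInter_mem hs fun i => hf i i.2

theorem empty_mem (hB : IsKappaAlgebra κ B) : ∅ ∈ B := by
  simpa using hB.sUnion_mem ∅ (Set.empty_subset _) (by simp)

theorem univ_mem (hB : IsKappaAlgebra κ B) : Set.univ ∈ B := by
  simpa using hB.compl_mem _ hB.empty_mem

theorem union_mem (hB : IsKappaAlgebra κ B) (hκ : ℵ₀ ≤ κ) {A A' : Set X} (hA : A ∈ B)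
    (hA' : A' ∈ B) : A ∪ A' ∈ B := by
  have h : #({A, A'} : Set (Set X)) ≤ κ :=
    (Cardinal.le_aleph0_iff_set_countable.2 (Set.toFinite _).countable).trans hκ
  simpa using hB.sUnion_mem {A, A'} (by rintro _ (rfl | rfl) <;> assumption) h

theorem inter_mem (hB : IsKappaAlgebra κ B) (hκ : ℵ₀ ≤ κ) {A A' : Set X} (hA : A ∈ B)
    (hA' : A' ∈ B) : A ∩ A' ∈ B := by
  rw [← compl_compl (A ∩ A'), Set.compl_inter]
  exact hB.compl_mem _ (hB.union_mem hκ (hB.compl_mem _ hA) (hB.compl_mem _ hA'))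

theorem diff_mem (hB : IsKappaAlgebra κ B) (hκ : ℵ₀ ≤ κ) {A A' : Set X} (hA : A ∈ B)
    (hA' : A' ∈ B) : A \ A' ∈ B :=
  hB.inter_mem hκ hA (hB.compl_mem _ hA')

/-- A condition that does not depend on the point may be imposed on a member of the algebra. -/
theorem sep_const_mem (hB : IsKappaAlgebra κ B) (q : Prop) {A : Set X} (hA : q → A ∈ B) :
    {x | q ∧ x ∈ A} ∈ B := by
  by_cases hq : q
  · simpa [hq] using hA hq
  · simpa [hq] using hB.empty_mem

/-- The sets whose preimages belong to a `κ⁺`-algebra form a `κ⁺`-algebra. -/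
theorem preimage (hB : IsKappaAlgebra κ B) (f : X → Y) :
    IsKappaAlgebra κ {A : Set Y | f ⁻¹' A ∈ B} where
  compl_mem A hA := hB.compl_mem _ hA
  sUnion_mem C hC hκ := by
    change f ⁻¹' ⋃₀ C ∈ B
    rw [Set.preimage_sUnion]
    exact hB.biUnion_mem hκ fun A hA => hC hA

theorem mem_of_mk_le (hB : IsKappaAlgebra κ B) (hs : ∀ x : X, {x} ∈ B) {A : Set X}
    (hA : #A ≤ κ) : A ∈ B := by
  rw [← Set.biUnion_of_singleton A]
  exact hB.biUnion_mem hA fun x _ => hs x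

end IsKappaAlgebra

end Algebra

/-! ### Sequences of length less than `κ` -/

section Sequences

variable {κ : Cardinal.{u}}

theorem mk_Iio_lt (α : κ.ord.ToType) : #(Set.Iio α) < κ := by
  have h := Cardinal.mk_Iio_lt α (by rw [mk_ord_toType, Ordinal.type_toType])
  rwa [mk_ord_toType] at h

theorem mk_Iio_le (α : κ.ord.ToType) : #(Set.Iio α) ≤ κ := (mk_Iio_lt α).le

theorem exists_forall_lt_of_mk_lt (hreg : κ.IsRegular) {S : Set κ.ord.ToType} (hS : #S < κ) :
    ∃ δ, ∀ ξ ∈ S, ξ < δ := by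
  by_contra! h
  have hc : IsCofinal S := fun δ => by
    obtain ⟨ξ, h1, h2⟩ := h δ
    exact ⟨ξ, h1, h2⟩
  have := Order.cof_le hc
  rw [Ordinal.cof_toType, hreg.cof_ord] at this
  exact absurd hS this.not_gt

theorem mk_pi_Iio_le (hunc : ℵ₀ < κ) (hpow : (2 : Cardinal.{u}) ^< κ = κ)
    (α β : κ.ord.ToType) : #(Set.Iio α → Set.Iio β) ≤ κ := by
  set μ : Cardinal.{u} := max ℵ₀ (max #(Set.Iio α) #(Set.Iio β))
  have hμ : μ < κ := max_lt hunc (max_lt (mk_Iio_lt α) (mk_Iio_lt β))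
  have h0 : ℵ₀ ≤ μ := le_max_left _ _
  have hα : #(Set.Iio α) ≤ μ := (le_max_left _ _).trans (le_max_right _ _)
  have hβ : #(Set.Iio β) ≤ μ := (le_max_right _ _).trans (le_max_right _ _)
  calc #(Set.Iio α → Set.Iio β) = #(Set.Iio β) ^ #(Set.Iio α) := by simp
    _ ≤ μ ^ #(Set.Iio α) := Cardinal.power_le_power_right hβ
    _ ≤ μ ^ μ := Cardinal.power_le_power_left (aleph0_pos.trans_le h0).ne' hα
    _ = 2 ^ μ := Cardinal.power_self_eq h0
    _ ≤ κ := hpow ▸ Cardinal.le_powerlt 2 hμ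

/-- The assumption on `κ` says that there are only `κ` many sequences of length less than `κ`:
by regularity, every such sequence is bounded. -/
theorem mk_seq_le (hunc : ℵ₀ < κ) (hreg : κ.IsRegular) (hpow : (2 : Cardinal.{u}) ^< κ = κ)
    (α : κ.ord.ToType) : #(Set.Iio α → κ.ord.ToType) ≤ κ := by
  have hsurj : Function.Surjective
      (fun t : Σ β : κ.ord.ToType, (Set.Iio α → Set.Iio β) =>
        (fun ξ => (t.2 ξ : κ.ord.ToType) : Set.Iio α → κ.ord.ToType)) := fun s => by
    obtain ⟨δ, hδ⟩ := exists_forall_lt_of_mk_lt hreg (S := Set.range s)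
      (mk_range_le.trans_lt (mk_Iio_lt α))
    exact ⟨⟨δ, fun ξ => ⟨s ξ, hδ _ ⟨ξ, rfl⟩⟩⟩, rfl⟩
  refine (mk_le_of_surjective hsurj).trans ?_
  rw [mk_sigma]
  refine (sum_le_sum _ (fun _ => κ) fun β => mk_pi_Iio_le hunc hpow α β).trans ?_
  simp [mul_eq_self hreg.aleph0_le]

theorem mk_sigma_seq_le (hunc : ℵ₀ < κ) (hreg : κ.IsRegular)
    (hpow : (2 : Cardinal.{u}) ^< κ = κ) :
    #(Σ α : κ.ord.ToType, (Set.Iio α → κ.ord.ToType)) ≤ κ := by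
  rw [mk_sigma]
  refine (sum_le_sum _ (fun _ => κ) fun α => mk_seq_le hunc hreg hpow α).trans ?_
  simp [mul_eq_self hreg.aleph0_le]

theorem toType_nonempty (hκ : ℵ₀ ≤ κ) : Nonempty κ.ord.ToType := by
  rw [← mk_ne_zero_iff, mk_ord_toType]
  exact (aleph0_pos.trans_le hκ).ne'

theorem noMaxOrder_toType (hκ : ℵ₀ ≤ κ) : NoMaxOrder κ.ord.ToType :=
  Cardinal.noMaxOrder hκ

open Classical in
/-- A sequence of length `α`, continued by a constant value. -/
noncomputable def extendSeq {A : Type u} (a : A) (α : κ.ord.ToType) (s : Set.Iio α → A) :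
    κ.ord.ToType → A :=
  fun β => if h : β < α then s ⟨β, h⟩ else a

theorem extendSeq_of_lt {A : Type u} (a : A) {α β : κ.ord.ToType} (s : Set.Iio α → A)
    (h : β < α) : extendSeq a α s β = s ⟨β, h⟩ := by
  simp [extendSeq, h]

/-- Recursion along `κ` for a step relation that only looks at the earlier values. -/
theorem exists_forall_step {A : Type u} [Nonempty A]
    (P : κ.ord.ToType → (κ.ord.ToType → A) → A → Prop)
    (hcongr : ∀ α y y' a, (∀ β < α, y β = y' β) → P α y a → P α y' a)
    (hex : ∀ α y, ∃ a, P α y a) : ∃ y : κ.ord.ToType → A, ∀ α, P α y (y α) := by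
  classical
  obtain ⟨a₀⟩ := ‹Nonempty A›
  choose g hg using hex
  let step : (α : κ.ord.ToType) → ((β : κ.ord.ToType) → β < α → A) → A :=
    fun α s => g α (extendSeq a₀ α fun β => s β β.2)
  let y : κ.ord.ToType → A := (wellFounded_lt (α := κ.ord.ToType)).fix step
  have hy : ∀ α, y α = g α (extendSeq a₀ α fun β => y β) := fun α =>
    WellFounded.fix_eq _ step α
  refine ⟨y, fun α => ?_⟩
  rw [hy α]
  exact hcongr α _ _ _ (fun β hβ => extendSeq_of_lt _ _ hβ) (hg _ _)

/-- Let `F` be such that the sets where `F` takes values extending a given sequence of length `α`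
belong to the algebra. Then a condition given by members of the algebra may be made to depend on
`F x` below `α`. -/
theorem setOf_mem_of_agree {X : Type u} {B : Set (Set X)} (hunc : ℵ₀ < κ) (hreg : κ.IsRegular)
    (hpow : (2 : Cardinal.{u}) ^< κ = κ) (hB : IsKappaAlgebra κ B) (F : X → Baire κ)
    (α : κ.ord.ToType) (hF : ∀ y : Baire κ, {x | ∀ β < α, F x β = y β} ∈ B)
    (S : Baire κ → Set X) (hS : ∀ y, S y ∈ B)
    (hdep : ∀ y y' : Baire κ, (∀ β < α, y β = y' β) → S y = S y') :
    {x | x ∈ S (F x)} ∈ B := by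
  obtain ⟨a⟩ := toType_nonempty hreg.aleph0_le
  have : {x | x ∈ S (F x)} = ⋃ s : Set.Iio α → κ.ord.ToType,
      {x | ∀ β < α, F x β = extendSeq a α s β} ∩ S (extendSeq a α s) := by
    ext x
    simp only [Set.mem_ofPred_eq, Set.mem_iUnion, Set.mem_inter_iff]
    constructor
    · intro hx
      have h : ∀ β < α, F x β = extendSeq a α (fun ξ => F x ξ) β :=
        fun β hβ => (extendSeq_of_lt a (fun ξ : Set.Iio α => F x ξ) hβ).symm
      exact ⟨fun ξ => F x ξ, h, hdep _ _ h ▸ hx⟩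
    · rintro ⟨s, h, hx⟩
      rwa [hdep _ _ h]
  rw [this]
  exact hB.iUnion_mem (mk_seq_le hunc hreg hpow α) fun s =>
    hB.inter_mem hreg.aleph0_le (hF _) (hS _)

end Sequences

/-! ### The algebra generated by the coordinates of a map into the Baire space -/

section Coord

variable {κ : Cardinal.{u}} {X : Type u}

/-- The `κ⁺`-algebra generated by the sets on which a coordinate of `Φ` has a given value. -/
def coordAlgebra (Φ : X → Baire κ) : Set (Set X) :=
  generatedAlgebra κ {A | ∃ ζ k : κ.ord.ToType, A = {x | Φ x ζ = k}}

theorem isKappaAlgebra_coordAlgebra (Φ : X → Baire κ) : IsKappaAlgebra κ (coordAlgebra Φ) :=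
  isKappaAlgebra_generatedAlgebra _

theorem coord_mem_coordAlgebra (Φ : X → Baire κ) (ζ k : κ.ord.ToType) :
    {x | Φ x ζ = k} ∈ coordAlgebra Φ :=
  subset_generatedAlgebra _ ⟨ζ, k, rfl⟩

theorem coordAlgebra_subset {B : Set (Set X)} (hB : IsKappaAlgebra κ B) {Φ : X → Baire κ}
    (h : ∀ ζ k, {x | Φ x ζ = k} ∈ B) : coordAlgebra Φ ⊆ B :=
  generatedAlgebra_subset hB (by rintro _ ⟨ζ, k, rfl⟩; exact h ζ k)

theorem agree_mem {B : Set (Set X)} (hB : IsKappaAlgebra κ B) {Φ : X → Baire κ}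
    (h : ∀ ζ k, {x | Φ x ζ = k} ∈ B) (α : κ.ord.ToType) (y : Baire κ) :
    {x | ∀ β < α, Φ x β = y β} ∈ B := by
  have : {x | ∀ β < α, Φ x β = y β} = ⋂ β ∈ Set.Iio α, {x | Φ x β = y β} := by
    ext; simp
  rw [this]
  exact hB.biInter_mem (mk_Iio_le α) fun β _ => h β _

theorem singleton_mem_coordAlgebra {Φ : X → Baire κ} (hΦ : Function.Injective Φ) (x : X) :
    {x} ∈ coordAlgebra Φ := by
  have : {x} = ⋂ ζ, {y | Φ y ζ = Φ x ζ} := by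
    ext y
    simp only [Set.mem_singleton_iff, Set.mem_iInter, Set.mem_ofPred_eq]
    exact ⟨fun h _ => h ▸ rfl, fun h => hΦ (funext h)⟩
  rw [this]
  exact (isKappaAlgebra_coordAlgebra Φ).iInter_mem (mk_ord_toType κ).le
    fun ζ => coord_mem_coordAlgebra Φ ζ _

/-- Changing an injection at `κ` many points does not affect the algebra generated by its
coordinates, as long as the map stays injective. -/
theorem coordAlgebra_subset_of_eqOn_compl (hκ : ℵ₀ ≤ κ) {Φ Ψ : X → Baire κ}
    (hΨ : Function.Injective Ψ) {Z : Set X} (hZ : #Z ≤ κ) (h : Set.EqOn Φ Ψ Zᶜ) :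
    coordAlgebra Φ ⊆ coordAlgebra Ψ := by
  have hB := isKappaAlgebra_coordAlgebra Ψ
  have hsmall : ∀ A ⊆ Z, A ∈ coordAlgebra Ψ := fun A hA =>
    hB.mem_of_mk_le (singleton_mem_coordAlgebra hΨ) ((mk_le_mk_of_subset hA).trans hZ)
  refine coordAlgebra_subset hB fun ζ k => ?_
  have : {x | Φ x ζ = k} = ({x | Φ x ζ = k} ∩ Z) ∪ ({x | Ψ x ζ = k} \ Z) := by
    ext x
    by_cases hx : x ∈ Z
    · simp [hx]
    · simp [hx, h hx]
  rw [this]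
  exact hB.union_mem hκ (hsmall _ Set.inter_subset_right)
    (hB.diff_mem hκ (coord_mem_coordAlgebra Ψ ζ k) (hsmall _ subset_rfl))

theorem coordAlgebra_eq_of_eqOn_compl (hκ : ℵ₀ ≤ κ) {Φ Ψ : X → Baire κ}
    (hΦ : Function.Injective Φ) (hΨ : Function.Injective Ψ) {Z : Set X} (hZ : #Z ≤ κ)
    (h : Set.EqOn Φ Ψ Zᶜ) : coordAlgebra Φ = coordAlgebra Ψ :=
  (coordAlgebra_subset_of_eqOn_compl hκ hΨ hZ h).antisymm
    (coordAlgebra_subset_of_eqOn_compl hκ hΦ hZ h.symm)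

theorem isOpen_agree (α : κ.ord.ToType) (y : Baire κ) :
    IsOpen[boundedTopology κ] {z : Baire κ | ∀ β < α, z β = y β} :=
  TopologicalSpace.isOpen_generateFrom_of_mem
    ⟨α, fun β => y β, by ext z; simp⟩

theorem isOpen_boundedTopology_iff (hκ : ℵ₀ ≤ κ) (U : Set (Baire κ)) :
    IsOpen[boundedTopology κ] U ↔
      ∀ y ∈ U, ∃ α : κ.ord.ToType, {z : Baire κ | ∀ β < α, z β = y β} ⊆ U := by
  constructor
  · intro hU
    induction hU with
    | basic U hU =>
      obtain ⟨α, s, rfl⟩ := hU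
      intro y hy
      refine ⟨α, fun z hz β => ?_⟩
      rw [hz β β.2, hy β]
    | univ =>
      obtain ⟨a⟩ := toType_nonempty hκ
      exact fun y _ => ⟨a, Set.subset_univ _⟩
    | inter U V _ _ hU hV =>
      intro y hy
      obtain ⟨α, hα⟩ := hU y hy.1
      obtain ⟨β, hβ⟩ := hV y hy.2
      exact ⟨max α β, fun z hz => ⟨hα fun ξ h => hz ξ (lt_max_of_lt_left h),
        hβ fun ξ h => hz ξ (lt_max_of_lt_right h)⟩⟩
    | sUnion C _ hC =>
      rintro y ⟨U, hU, hy⟩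
      obtain ⟨α, hα⟩ := hC U hU y hy
      exact ⟨α, hα.trans (Set.subset_sUnion_of_mem hU)⟩
  · intro h
    let _ := boundedTopology κ
    refine isOpen_iff_forall_mem_open.2 fun y hy => ?_
    obtain ⟨α, hα⟩ := h y hy
    exact ⟨_, hα, isOpen_agree α y, fun _ _ => rfl⟩

/-- A set is open for the topology induced by `Ψ` if and only if, with each point, it contains all
points whose images extend a common initial segment. -/
theorem isOpen_induced_iff_agree (hκ : ℵ₀ ≤ κ) (Ψ : X → Baire κ) (U : Set X) :
    IsOpen[.induced Ψ (boundedTopology κ)] U ↔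
      ∀ x ∈ U, ∃ α : κ.ord.ToType, {x' | ∀ β < α, Ψ x' β = Ψ x β} ⊆ U := by
  let _ := boundedTopology κ
  rw [isOpen_induced_iff]
  constructor
  · rintro ⟨V, hV, rfl⟩ x hx
    obtain ⟨α, hα⟩ := (isOpen_boundedTopology_iff hκ V).1 hV _ hx
    exact ⟨α, fun x' hx' => hα hx'⟩
  · intro h
    have := toType_nonempty hκ
    choose! δ hδ using h
    refine ⟨⋃ x ∈ U, {z | ∀ β < δ x, z β = Ψ x β},
      isOpen_biUnion fun x _ => isOpen_agree _ _, ?_⟩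
    ext x'
    simp only [Set.mem_preimage, Set.mem_iUnion]
    constructor
    · rintro ⟨x, hx, hx'⟩
      exact hδ x hx hx'
    · exact fun hx' => ⟨x', hx', fun _ _ => rfl⟩

/-- The `κ`-Borel sets for the topology induced by `Ψ` are generated by the coordinates. -/
theorem bor_induced (hunc : ℵ₀ < κ) (hreg : κ.IsRegular)
    (hpow : (2 : Cardinal.{u}) ^< κ = κ) (Ψ : X → Baire κ) :
    Bor κ (.induced Ψ (boundedTopology κ)) = coordAlgebra Ψ := by
  have hA := isKappaAlgebra_coordAlgebra Ψ
  refine Set.Subset.antisymm (generatedAlgebra_subset hA fun U hU => ?_)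
    (coordAlgebra_subset (isKappaAlgebra_generatedAlgebra _) fun ζ k => ?_)
  · have hU' := (isOpen_induced_iff_agree hreg.aleph0_le Ψ U).1 hU
    have : U = ⋃ α : κ.ord.ToType, {x | {x' | ∀ β < α, Ψ x' β = Ψ x β} ⊆ U} := by
      ext y
      simp only [Set.mem_iUnion, Set.mem_ofPred_eq]
      exact ⟨hU' y, fun ⟨α, h⟩ => h fun _ _ => rfl⟩
    rw [this]
    refine hA.iUnion_mem (mk_ord_toType κ).le fun α => ?_
    have := setOf_mem_of_agree hunc hreg hpow hA Ψ α
      (agree_mem hA (coord_mem_coordAlgebra _) α)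
      (fun y => {x | {x' | ∀ β < α, Ψ x' β = y β} ⊆ U ∧ x ∈ Set.univ})
      (fun y => hA.sep_const_mem _ fun _ => hA.univ_mem)
      (fun y y' h => by
        have : {x' | ∀ β < α, Ψ x' β = y β} = {x' | ∀ β < α, Ψ x' β = y' β} := by
          ext z
          exact forall₂_congr fun β hβ => by rw [h β hβ]
        simp only [this])
    simpa using this
  · refine subset_generatedAlgebra _
      ((isOpen_induced_iff_agree hreg.aleph0_le Ψ _).2 fun x hx => ?_)
    obtain ⟨α, hα⟩ := (noMaxOrder_toType hreg.aleph0_le).exists_gt ζ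
    exact ⟨α, fun z hz => (hz ζ hα).trans hx⟩

theorem bor_boundedTopology (hunc : ℵ₀ < κ) (hreg : κ.IsRegular)
    (hpow : (2 : Cardinal.{u}) ^< κ = κ) :
    Bor κ (boundedTopology κ) = coordAlgebra (id : Baire κ → Baire κ) := by
  rw [← bor_induced hunc hreg hpow, @induced_id _ (boundedTopology κ)]

end Coord

/-! ### A tree of runs of the fair game -/

section Scheme

variable {κ : Cardinal.{u}} {X : Type u} {τ : TopologicalSpace X}

theorem reply_congr {σ : Strategy κ X} {p q : Moves κ X} {α : κ.ord.ToType}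
    (h : ∀ β ≤ α, p β = q β) : reply σ p α = reply σ q α := by
  have : (fun β : Set.Iic α => p β) = fun β : Set.Iic α => q β := funext fun β => h β β.2
  simp only [reply, this]

theorem before_congr {σ : Strategy κ X} {p q : Moves κ X} {α : κ.ord.ToType}
    (h : ∀ β < α, p β = q β) : before σ p α = before σ q α :=
  Set.iInter₂_congr fun _ hβ => reply_congr fun γ hγ => h γ (lt_of_le_of_lt hγ hβ)

theorem legalI_congr {σ : Strategy κ X} {p q : Moves κ X} {α : κ.ord.ToType}
    (h : ∀ β ≤ α, p β = q β) : LegalI τ σ p α ↔ LegalI τ σ q α := by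
  rw [LegalI, LegalI, h α le_rfl, before_congr fun β hβ => h β (le_of_lt hβ)]

theorem before_anti (σ : Strategy κ X) (p : Moves κ X) : Antitone (before σ p) :=
  fun _ _ h => Set.biInter_mono (Set.Iio_subset_Iio h) fun _ _ => subset_rfl

/-- What is left at some round is covered by `κ` many possible answers of player II, where
player I plays points with prescribed neighbourhoods: this is the Lindelöf property given by the
bound on the weight. -/
theorem exists_covering_moves {σ : Strategy κ X} (hσ : WinningFair τ σ) (hw : WeightLE κ τ)
    {α : κ.ord.ToType} {O : X → Set X} (hO : ∀ x, IsOpen[τ] (O x) ∧ x ∈ O x) {q : Moves κ X}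
    (hq : ∀ β < α, LegalI τ σ q β) (hne : (before σ q α).Nonempty) :
    ∃ m : κ.ord.ToType → Set X × X,
      (∀ i, (m i).2 ∈ before σ q α ∧ (m i).1 = O (m i).2 ∩ before σ q α) ∧
      ∀ z ∈ before σ q α, ∃ i, z ∈ reply σ (Function.update q α (m i)) α := by
  classical
  obtain ⟨b, hbκ, hb⟩ := hw
  set S := before σ q α
  let move : X → Set X × X := fun x => (O x ∩ S, x)
  let run : X → Moves κ X := fun x => Function.update q α (move x)
  have hrun : ∀ x, ∀ β < α, q β = run x β := fun x β hβ =>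
    (Function.update_of_ne hβ.ne _ _).symm
  have hS : ∀ x, before σ (run x) α = S := fun x => (before_congr (hrun x)).symm
  have hlegal : ∀ x ∈ S, LegalII τ σ (run x) α := fun x hx => by
    refine (hσ (run x)).1 α fun β hβ => ?_
    rcases hβ.lt_or_eq with h | rfl
    · exact (legalI_congr fun γ hγ => hrun x γ (hγ.trans_lt h)).1 (hq β h)
    · refine ⟨?_, O x, (hO x).1, ?_⟩
      · simpa [run, move] using ⟨(hO x).2, hx⟩
      · simp [hS, run, move]
  have hbx : ∀ x : S, ∃ u : b, (x : X) ∈ (u : Set X) ∧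
      (u : Set X) ∩ S ⊆ reply σ (run x) α := fun x => by
    obtain ⟨h1, -, G, hG, hGr⟩ := hlegal x x.2
    rw [hS] at hGr
    have hxG : (x : X) ∈ G := by
      have : (run x α).2 = x := by simp [run, move]
      rw [this, hGr] at h1
      exact h1.1
    obtain ⟨u, hu, hxu, huG⟩ := hb.exists_subset_of_mem_open hxG hG
    exact ⟨⟨u, hu⟩, hxu, hGr ▸ Set.inter_subset_inter_left _ huG⟩
  choose u hxu hu using hbx
  have hcard : #(Set.range u) ≤ #κ.ord.ToType := by
    rw [mk_ord_toType]
    exact (mk_set_le _).trans hbκ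
  have : Nonempty (Set.range u) := by
    obtain ⟨x, hx⟩ := hne
    exact ⟨⟨_, ⟨x, hx⟩, rfl⟩⟩
  obtain ⟨e⟩ := hcard
  have hsurj := Function.invFun_surjective e.injective
  choose x hx using fun i => (Function.invFun e i).2
  refine ⟨fun i => move (x i), fun i => ⟨(x i).2, rfl⟩, fun z hz => ?_⟩
  obtain ⟨i, hi⟩ := hsurj ⟨u ⟨z, hz⟩, _, rfl⟩
  refine ⟨i, hu (x i) ⟨?_, hz⟩⟩
  rw [hx i, hi]
  exact hxu ⟨z, hz⟩

/-- Neighbourhoods on level `α` which decide the `α`-th pair of an enumeration `g`: they are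
contained in the second set of the pair or disjoint from the first one, provided that the closure
of the first set is contained in the second one. -/
theorem exists_deciding_nhds [τ : TopologicalSpace X] (g : κ.ord.ToType → Set X × Set X)
    (hg : ∀ α, IsOpen (g α).2) :
    ∃ O : κ.ord.ToType → X → Set X, (∀ α x, IsOpen (O α x) ∧ x ∈ O α x) ∧
      ∀ α x, closure (g α).1 ⊆ (g α).2 → O α x ⊆ (g α).2 ∨ Disjoint (O α x) (g α).1 := by
  classical
  refine ⟨fun α x => if x ∈ (g α).2 then (g α).2 else
    if x ∈ closure (g α).1 then Set.univ else (closure (g α).1)ᶜ, fun α x => ?_,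
    fun α x h => ?_⟩
  · dsimp only
    split_ifs with h1 h2
    · exact ⟨hg α, h1⟩
    · exact ⟨isOpen_univ, trivial⟩
    · exact ⟨isClosed_closure.isOpen_compl, h2⟩
  · dsimp only
    split_ifs with h1 h2
    · exact Or.inl subset_rfl
    · exact (h1 (h h2)).elim
    · exact Or.inr (Set.disjoint_left.2 fun z hz hz' => hz (subset_closure hz'))

/-- The intersection of the sets with index below `α` on the branch `y`. -/
def remaining (W : Baire κ → κ.ord.ToType → Set X) (y : Baire κ) (α : κ.ord.ToType) : Set X :=
  ⋂ β ∈ Set.Iio α, W y β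

/-- A tree of sets along the Baire space: `W y α` is attached to the sequence of the values of
`y` up to and including `α`. The immediate successors of a node cover what is left at this node
and are relatively open in it, those of level `α` are contained in sets `O α x`, and branches all
of whose nodes are nonempty have a nonempty intersection. -/
structure IsScheme (τ : TopologicalSpace X) (O : κ.ord.ToType → X → Set X)
    (W : Baire κ → κ.ord.ToType → Set X) : Prop where
  congr : ∀ α y y', (∀ β ≤ α, y β = y' β) → W y α = W y' α
  relOpen : ∀ y α, (remaining W y α).Nonempty → RelOpen τ (remaining W y α) (W y α)
  subset : ∀ y α, (remaining W y α).Nonempty → ∃ x, W y α ⊆ O α x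
  cover : ∀ y α, ∀ z ∈ remaining W y α, ∃ i, z ∈ W (Function.update y α i) α
  nonempty : ∀ y, (∀ α, (remaining W y α).Nonempty) → (⋂ α, W y α).Nonempty

/-- A winning strategy for player II yields a scheme. Along a branch `y`, player I follows a run in
which move `α` is the `y α`-th member of a covering family of moves, chosen in terms of the earlier
moves; the sets of the scheme are the answers of player II. -/
theorem exists_isScheme {σ : Strategy κ X} (hσ : WinningFair τ σ)
    (hw : WeightLE κ τ) [Nonempty X] {O : κ.ord.ToType → X → Set X}
    (hO : ∀ α x, IsOpen[τ] (O α x) ∧ x ∈ O α x) :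
    ∃ W : Baire κ → κ.ord.ToType → Set X, IsScheme τ O W := by
  classical
  obtain ⟨x₀⟩ := ‹Nonempty X›
  have hex : ∀ (α : κ.ord.ToType) (q : Moves κ X), ∃ m : κ.ord.ToType → Set X × X,
      (∀ β < α, LegalI τ σ q β) → (before σ q α).Nonempty →
      (∀ i, (m i).2 ∈ before σ q α ∧ (m i).1 = O α (m i).2 ∩ before σ q α) ∧
      ∀ z ∈ before σ q α, ∃ i, z ∈ reply σ (Function.update q α (m i)) α := fun α q => by
    by_cases h : (∀ β < α, LegalI τ σ q β) ∧ (before σ q α).Nonempty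
    · obtain ⟨m, hm⟩ := exists_covering_moves hσ hw (hO α) h.1 h.2
      exact ⟨m, fun _ _ => hm⟩
    · exact ⟨fun _ => (∅, x₀), fun h1 h2 => (h ⟨h1, h2⟩).elim⟩
  choose m₀ hm₀ using hex
  -- The choice of the moves may only depend on the earlier part of the run.
  let trunc : κ.ord.ToType → Moves κ X → Moves κ X := fun α q =>
    extendSeq (∅, x₀) α fun β => q β
  have htrunc : ∀ α q, ∀ β < α, trunc α q β = q β := fun α q β hβ =>
    extendSeq_of_lt _ _ hβ
  have htrunc' : ∀ α (q q' : Moves κ X), (∀ β < α, q β = q' β) → trunc α q = trunc α q' :=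
    fun α q q' h => by
      have : (fun β : Set.Iio α => q β) = fun β : Set.Iio α => q' β := funext fun β => h β β.2
      simp only [trunc, this]
  let m : κ.ord.ToType → Moves κ X → κ.ord.ToType → Set X × X := fun α q => m₀ α (trunc α q)
  have hm : ∀ α q, (∀ β < α, LegalI τ σ q β) → (before σ q α).Nonempty →
      (∀ i, (m α q i).2 ∈ before σ q α ∧
        (m α q i).1 = O α (m α q i).2 ∩ before σ q α) ∧
      ∀ z ∈ before σ q α, ∃ i, z ∈ reply σ (Function.update q α (m α q i)) α :=
    fun α q h1 h2 => by
      have hb : before σ (trunc α q) α = before σ q α := before_congr (htrunc α q)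
      have := hm₀ α (trunc α q)
        (fun β hβ => (legalI_congr fun γ hγ => htrunc α q γ (hγ.trans_lt hβ)).2 (h1 β hβ))
        (hb ▸ h2)
      rw [hb] at this
      refine ⟨this.1, fun z hz => ?_⟩
      obtain ⟨i, hi⟩ := this.2 z hz
      refine ⟨i, ?_⟩
      rwa [reply_congr (q := Function.update (trunc α q) α (m α q i))]
      intro β hβ
      rcases hβ.lt_or_eq with h | rfl
      · simp [Function.update_of_ne h.ne, htrunc α q β h]
      · simp
  have hrun : ∀ y : Baire κ, ∃ p : Moves κ X, ∀ α, p α = m α p (y α) := fun y =>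
    exists_forall_step (A := Set X × X) (fun α q a => a = m α q (y α))
      (fun α q q' a h ha => by simp only [m, ← htrunc' α q q' h]; exact ha)
      fun α q => ⟨_, rfl⟩
  choose p hp using hrun
  have hpc : ∀ α y y', (∀ β ≤ α, y β = y' β) → p y α = p y' α := by
    intro α
    induction α using WellFoundedLT.induction with
    | ind α ih =>
      intro y y' h
      have : trunc α (p y) = trunc α (p y') := htrunc' _ _ _ fun β hβ =>
        ih β hβ y y' fun γ hγ => h γ (hγ.trans hβ.le)
      rw [hp y, hp y', h α le_rfl]
      simp only [m, this]
  have hlegal : ∀ y α, (∀ β ≤ α, (before σ (p y) β).Nonempty) → LegalI τ σ (p y) α := by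
    intro y α
    induction α using WellFoundedLT.induction with
    | ind α ih =>
      intro h
      have := ((hm α (p y) (fun β hβ => ih β hβ fun γ hγ => h γ (hγ.trans hβ.le))
        (h α le_rfl)).1 (y α))
      rw [← hp] at this
      exact ⟨this.2 ▸ ⟨(hO _ _).2, this.1⟩, _, (hO _ _).1, this.2⟩
  have hne : ∀ {y α}, (before σ (p y) α).Nonempty → ∀ β ≤ α, LegalI τ σ (p y) β :=
    fun {y α} h β hβ => hlegal y β fun γ hγ =>
      h.mono (before_anti σ (p y) (hγ.trans hβ))
  refine ⟨fun y α => reply σ (p y) α, ?_, ?_, ?_, ?_, ?_⟩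
  · exact fun α y y' h => reply_congr fun β hβ => hpc β y y' fun γ hγ => h γ (hγ.trans hβ)
  · exact fun y α h => ((hσ (p y)).1 α (hne h)).2.2
  · intro y α h
    have := (hm α (p y) (fun β hβ => hne h β hβ.le) h).1 (y α)
    rw [← hp] at this
    refine ⟨(p y α).2, ((hσ (p y)).1 α (hne h)).2.1.trans ?_⟩
    rw [this.2]
    exact Set.inter_subset_left
  · intro y α z hz
    obtain ⟨i, hi⟩ := (hm α (p y) (fun β hβ => hne ⟨z, hz⟩ β hβ.le) ⟨z, hz⟩).2 z hz
    refine ⟨i, ?_⟩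
    have hlt : ∀ β < α, p y β = p (Function.update y α i) β := fun β hβ =>
      hpc β _ _ fun γ hγ => (Function.update_of_ne (hγ.trans_lt hβ).ne _ _).symm
    rwa [reply_congr (q := Function.update (p y) α (m α (p y) i))]
    intro β hβ
    rcases hβ.lt_or_eq with h | rfl
    · rw [Function.update_of_ne h.ne, hlt β h]
    · have : trunc β (p y) = trunc β (p (Function.update y β i)) := htrunc' _ _ _ hlt
      rw [hp]
      simp [m, this]
  · exact fun y h => (hσ (p y)).2 fun α => hne (h α) α le_rfl

end Scheme

/-! ### From the fair game to a standard space -/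

namespace IsScheme

variable {κ : Cardinal.{u}} {X : Type u} {τ : TopologicalSpace X}
  {O : κ.ord.ToType → X → Set X} {W : Baire κ → κ.ord.ToType → Set X}

theorem remaining_congr (hW : IsScheme τ O W) {α : κ.ord.ToType} {y y' : Baire κ}
    (h : ∀ β < α, y β = y' β) : remaining W y α = remaining W y' α :=
  Set.iInter₂_congr fun _ hβ => hW.congr _ _ _ fun γ hγ => h γ (lt_of_le_of_lt hγ hβ)

theorem update_congr (hW : IsScheme τ O W) {α i : κ.ord.ToType} {y y' : Baire κ}
    (h : ∀ β < α, y β = y' β) :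
    W (Function.update y α i) α = W (Function.update y' α i) α :=
  hW.congr _ _ _ fun β hβ => by
    rcases hβ.lt_or_eq with h' | rfl
    · simp [Function.update_of_ne h'.ne, h β h']
    · simp

theorem remaining_update (hW : IsScheme τ O W) (y : Baire κ) (α i : κ.ord.ToType) :
    remaining W (Function.update y α i) α = remaining W y α :=
  hW.remaining_congr fun _ hβ => Function.update_of_ne hβ.ne _ _

theorem remaining_anti (y : Baire κ) : Antitone (remaining W y) :=
  fun _ _ h => Set.biInter_mono (Set.Iio_subset_Iio h) fun _ _ => subset_rfl

theorem mem_of_nonempty (hW : IsScheme τ O W) {B : Set (Set X)} (hκ : ℵ₀ ≤ κ)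
    (hB : IsKappaAlgebra κ B) (hτ : ∀ U, IsOpen[τ] U → U ∈ B) (y : Baire κ) (α : κ.ord.ToType)
    (hne : (remaining W y α).Nonempty) : W y α ∈ B := by
  induction α using WellFoundedLT.induction with
  | ind α ih =>
    obtain ⟨G, hG, h⟩ := hW.relOpen y α hne
    rw [h]
    exact hB.inter_mem hκ (hτ _ hG) (hB.biInter_mem (mk_Iio_le α) fun β hβ =>
      ih β hβ (hne.mono (remaining_anti y (le_of_lt hβ))))

/-- The branches of the scheme: the members of the Baire space along which every node is
nonempty. -/
def branches (W : Baire κ → κ.ord.ToType → Set X) : Set (Baire κ) :=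
  {y | ∀ α, (remaining W y α).Nonempty}

/-- The branches whose intersection meets `A`. -/
def branchesOf (W : Baire κ → κ.ord.ToType → Set X) (A : Set X) : Set (Baire κ) :=
  {y | y ∈ branches W ∧ ∃ x ∈ A, ∀ α, x ∈ W y α}

/-- At level `α`, the branch `y` chooses the first node containing `x`. If this holds at all
levels, then `y` is the code of `x`. -/
def IsCode (W : Baire κ → κ.ord.ToType → Set X) (x : X) (y : Baire κ) (α : κ.ord.ToType) :
    Prop :=
  x ∈ W y α ∧ ∀ i < y α, x ∉ W (Function.update y α i) α

theorem exists_isCode (hκ : ℵ₀ ≤ κ) (hW : IsScheme τ O W) (x : X) :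
    ∃ y, ∀ α, IsCode W x y α := by
  have := toType_nonempty hκ
  obtain ⟨y, hy⟩ := exists_forall_step (κ := κ) (A := κ.ord.ToType)
    (fun α y i => x ∈ remaining W y α → x ∈ W (Function.update y α i) α ∧
      ∀ j < i, x ∉ W (Function.update y α j) α)
    (fun α y y' i h => by
      simp only [hW.remaining_congr h, hW.update_congr h]
      exact id)
    (fun α y => by
      by_cases hx : x ∈ remaining W y α
      · obtain ⟨i, hi, hmin⟩ := wellFounded_lt.has_min
          {i | x ∈ W (Function.update y α i) α} (hW.cover y α x hx)
        exact ⟨i, fun _ => ⟨hi, fun j hj hj' => hmin j hj' hj⟩⟩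
      · obtain ⟨a⟩ := this
        exact ⟨a, fun h => (hx h).elim⟩)
  refine ⟨y, fun α => ?_⟩
  induction α using WellFoundedLT.induction with
  | ind α ih =>
    have := hy α (Set.mem_iInter₂.2 fun β hβ => (ih β hβ).1)
    rwa [Function.update_eq_self] at this

theorem eq_of_isCode (hW : IsScheme τ O W) {x : X} {y y' : Baire κ} {α : κ.ord.ToType}
    (hy : ∀ β < α, IsCode W x y β) (hy' : ∀ β < α, IsCode W x y' β) :
    ∀ β < α, y β = y' β := by
  intro β
  induction β using WellFoundedLT.induction with
  | ind β ih =>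
    intro hβ
    have hlt : ∀ γ < β, y γ = y' γ := fun γ hγ => ih γ hγ (hγ.trans hβ)
    by_contra hne
    rcases lt_or_gt_of_ne hne with h | h
    · apply (hy' β hβ).2 _ h
      rw [← hW.update_congr hlt, Function.update_eq_self]
      exact (hy β hβ).1
    · apply (hy β hβ).2 _ h
      rw [hW.update_congr hlt, Function.update_eq_self]
      exact (hy' β hβ).1

theorem mem_branches {x : X} {y : Baire κ} (h : ∀ α, x ∈ W y α) : y ∈ branches W :=
  fun _ => ⟨x, Set.mem_iInter₂.2 fun β _ => h β⟩

/-- The sets on a branch shrink to the points of its intersection. -/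
def Shrinks (τ : TopologicalSpace X) (W : Baire κ → κ.ord.ToType → Set X) : Prop :=
  ∀ y x, (∀ α, x ∈ W y α) → ∀ U, IsOpen[τ] U → x ∈ U → ∃ α, W y α ⊆ U

/-- Bookkeeping over all pairs of basic open sets makes the scheme of a regular space shrink: if the
closure of `u` is contained in `u'`, then some level of every branch is contained in `u'` or
disjoint from `u`. -/
theorem exists_shrinks (hκ : ℵ₀ ≤ κ) [Nonempty X] (h : IsFSC κ τ) :
    ∃ (O : _) (W : Baire κ → κ.ord.ToType → Set X), IsScheme τ O W ∧ Shrinks τ W := by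
  obtain ⟨h3, ⟨b, hbκ, hb⟩, σ, hσ⟩ := h
  let _ := τ
  obtain ⟨x₀⟩ := ‹Nonempty X›
  obtain ⟨u₀, hu₀, -, -⟩ := hb.exists_subset_of_mem_open (Set.mem_univ x₀) isOpen_univ
  have hcard : #(b × b) ≤ #κ.ord.ToType := by
    rw [mk_prod, lift_id, mk_ord_toType]
    exact (mul_le_mul' hbκ hbκ).trans (mul_eq_self hκ).le
  have : Nonempty (b × b) := ⟨⟨⟨u₀, hu₀⟩, ⟨u₀, hu₀⟩⟩⟩
  obtain ⟨e⟩ := hcard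
  have hsurj := Function.invFun_surjective e.injective
  obtain ⟨O, hO, hdec⟩ := exists_deciding_nhds
    (fun α => (((Function.invFun e α).1 : Set X), ((Function.invFun e α).2 : Set X)))
    (fun α => hb.isOpen (Function.invFun e α).2.2)
  have : Nonempty X := ⟨x₀⟩
  obtain ⟨W, hW⟩ := exists_isScheme hσ ⟨b, hbκ, hb⟩ hO
  refine ⟨O, W, hW, fun y x hx U hU hxU => ?_⟩
  obtain ⟨u', hu', hxu', hu'U⟩ := hb.exists_subset_of_mem_open hxU hU
  obtain ⟨t, ht, htc, htu⟩ := exists_mem_nhds_isClosed_subset ((hb.isOpen hu').mem_nhds hxu')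
  obtain ⟨u, hu, hxu, hut⟩ := hb.mem_nhds_iff.1 ht
  obtain ⟨α, hα⟩ := hsurj ⟨⟨u, hu⟩, ⟨u', hu'⟩⟩
  obtain ⟨z, hz⟩ := hW.subset y α (mem_branches hx α)
  have := hdec α z
  simp only [hα] at this
  refine ⟨α, ?_⟩
  rcases this ((closure_minimal hut htc).trans htu) with h | h
  · exact (hz.trans h).trans hu'U
  · exact (Set.disjoint_left.1 h (hz (hx α)) hxu).elim

theorem Shrinks.eq (hs : Shrinks τ W) (h : @T3Space X τ) {y : Baire κ} {x x' : X}
    (hx : ∀ α, x ∈ W y α) (hx' : ∀ α, x' ∈ W y α) : x = x' := by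
  by_contra hne
  let _ := τ
  obtain ⟨α, hα⟩ := hs y x hx {x'}ᶜ isOpen_compl_singleton hne
  exact hα (hx' α) rfl

section Borel

/-- A condition that depends only on the values below `α` defines a `κ`-Borel set. -/
theorem setOf_mem_bor (hunc : ℵ₀ < κ) (hreg : κ.IsRegular)
    (hpow : (2 : Cardinal.{u}) ^< κ = κ) (α : κ.ord.ToType) (S : Baire κ → Set (Baire κ))
    (hS : ∀ y, S y ∈ Bor κ (boundedTopology κ))
    (hdep : ∀ y y' : Baire κ, (∀ β < α, y β = y' β) → S y = S y') :
    {y | y ∈ S y} ∈ Bor κ (boundedTopology κ) :=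
  setOf_mem_of_agree hunc hreg hpow (isKappaAlgebra_generatedAlgebra _) id α
    (fun y => subset_generatedAlgebra _ (isOpen_agree α y)) S hS hdep

theorem setOf_mem_bor_of_dep (hunc : ℵ₀ < κ) (hreg : κ.IsRegular)
    (hpow : (2 : Cardinal.{u}) ^< κ = κ) (α : κ.ord.ToType) (P : Baire κ → Prop)
    (hdep : ∀ y y' : Baire κ, (∀ β < α, y β = y' β) → (P y ↔ P y')) :
    {y | P y} ∈ Bor κ (boundedTopology κ) := by
  have hA : IsKappaAlgebra κ (Bor κ (boundedTopology κ)) := isKappaAlgebra_generatedAlgebra _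
  have := setOf_mem_bor hunc hreg hpow α (fun y => {_z | P y ∧ _z ∈ Set.univ})
    (fun y => hA.sep_const_mem _ fun _ => hA.univ_mem)
    (fun y y' h => by simp only [hdep y y' h])
  simpa using this

theorem branches_mem_bor (hunc : ℵ₀ < κ) (hreg : κ.IsRegular)
    (hpow : (2 : Cardinal.{u}) ^< κ = κ) (hW : IsScheme τ O W) :
    branches W ∈ Bor κ (boundedTopology κ) := by
  have hA : IsKappaAlgebra κ (Bor κ (boundedTopology κ)) := isKappaAlgebra_generatedAlgebra _
  have : branches W = ⋂ α, {y | (remaining W y α).Nonempty} := by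
    ext; simp [branches]
  rw [this]
  exact hA.iInter_mem (mk_ord_toType κ).le fun α =>
    setOf_mem_bor_of_dep hunc hreg hpow α _ fun y y' h => by rw [hW.remaining_congr h]

/-- The map sending a branch to the point in its intersection is `κ`-Borel. -/
theorem branchesOf_mem_bor (hunc : ℵ₀ < κ) (hreg : κ.IsRegular)
    (hpow : (2 : Cardinal.{u}) ^< κ = κ) (hW : IsScheme τ O W) (hs : Shrinks τ W) (h3 : @T3Space X τ)
    {A : Set X} (hA : A ∈ Bor κ τ) : branchesOf W A ∈ Bor κ (boundedTopology κ) := by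
  have hBor : IsKappaAlgebra κ (Bor κ (boundedTopology κ)) := isKappaAlgebra_generatedAlgebra _
  have hC := branches_mem_bor hunc hreg hpow hW
  have hex : ∀ y ∈ branches W, ∃ x, ∀ α, x ∈ W y α := fun y hy => by
    obtain ⟨x, hx⟩ := hW.nonempty y hy
    exact ⟨x, Set.mem_iInter.1 hx⟩
  suffices Bor κ τ ⊆ {A | branchesOf W A ∈ Bor κ (boundedTopology κ)} from this hA
  refine generatedAlgebra_subset ⟨fun A hA => ?_, fun C hC' hκ => ?_⟩ fun U hU => ?_
  · have : branchesOf W Aᶜ = branches W \ branchesOf W A := by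
      ext y
      constructor
      · rintro ⟨hy, x, hxA, hx⟩
        refine ⟨hy, ?_⟩
        rintro ⟨-, x', hxA', hx'⟩
        exact hxA (hs.eq h3 hx hx' ▸ hxA')
      · rintro ⟨hy, hy'⟩
        obtain ⟨x, hx⟩ := hex y hy
        exact ⟨hy, x, fun hxA => hy' ⟨hy, x, hxA, hx⟩, hx⟩
    change branchesOf W Aᶜ ∈ Bor κ (boundedTopology κ)
    rw [this]
    exact hBor.diff_mem hreg.aleph0_le hC hA
  · have : branchesOf W (⋃₀ C) = ⋃ A ∈ C, branchesOf W A := by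
      ext y
      simp only [branchesOf, Set.mem_ofPred_eq, Set.mem_iUnion, Set.mem_sUnion]
      grind
    change branchesOf W (⋃₀ C) ∈ Bor κ (boundedTopology κ)
    rw [this]
    exact hBor.biUnion_mem hκ fun A hA => hC' hA
  · have : branchesOf W U = branches W ∩ ⋃ α, {y | W y α ⊆ U} := by
      ext y
      simp only [branchesOf, Set.mem_ofPred_eq, Set.mem_inter_iff, Set.mem_iUnion]
      refine and_congr_right fun hy => ⟨?_, ?_⟩
      · rintro ⟨x, hxU, hx⟩
        exact hs y x hx U hU hxU
      · rintro ⟨α, hα⟩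
        obtain ⟨x, hx⟩ := hex y hy
        exact ⟨x, hα (hx α), hx⟩
    change branchesOf W U ∈ Bor κ (boundedTopology κ)
    rw [this]
    refine hBor.inter_mem hreg.aleph0_le hC (hBor.iUnion_mem (mk_ord_toType κ).le fun α => ?_)
    obtain ⟨δ, hδ⟩ := (noMaxOrder_toType hreg.aleph0_le).exists_gt α
    exact setOf_mem_bor_of_dep hunc hreg hpow δ _ fun y y' h => by
      rw [hW.congr α y y' fun β hβ => h β (hβ.trans_lt hδ)]

/-- The codes of the points form a `κ`-Borel set. -/
theorem codes_mem_bor (hunc : ℵ₀ < κ) (hreg : κ.IsRegular)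
    (hpow : (2 : Cardinal.{u}) ^< κ = κ) (hW : IsScheme τ O W) (hs : Shrinks τ W) (h3 : @T3Space X τ) :
    {y | ∃ x, ∀ α, IsCode W x y α} ∈ Bor κ (boundedTopology κ) := by
  have hBor : IsKappaAlgebra κ (Bor κ (boundedTopology κ)) := isKappaAlgebra_generatedAlgebra _
  have hτ : IsKappaAlgebra κ (Bor κ τ) := isKappaAlgebra_generatedAlgebra _
  have : {y | ∃ x, ∀ α, IsCode W x y α} = branches W \ ⋃ α, ⋃ i, {y | i < y α ∧
      y ∈ {z | (remaining W y α).Nonempty ∧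
        z ∈ branchesOf W (W (Function.update y α i) α)}} := by
    ext y
    simp only [Set.mem_ofPred_eq, Set.mem_sdiff, Set.mem_iUnion, not_exists]
    constructor
    · rintro ⟨x, hx⟩
      refine ⟨mem_branches fun α => (hx α).1, fun α i => ?_⟩
      rintro ⟨hi, -, -, x', hxA', hx'⟩
      exact (hx α).2 i hi (hs.eq h3 (fun β => (hx β).1) hx' ▸ hxA')
    · rintro ⟨hy, hy'⟩
      obtain ⟨x, hx⟩ := hW.nonempty y hy
      rw [Set.mem_iInter] at hx
      exact ⟨x, fun α => ⟨hx α, fun i hi hxi => hy' α i ⟨hi, hy α, hy, x, hxi, hx⟩⟩⟩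
  rw [this]
  refine hBor.diff_mem hreg.aleph0_le (branches_mem_bor hunc hreg hpow hW)
    (hBor.iUnion_mem (mk_ord_toType κ).le fun α => hBor.iUnion_mem (mk_ord_toType κ).le
      fun i => ?_)
  obtain ⟨δ, hδ⟩ := (noMaxOrder_toType hreg.aleph0_le).exists_gt α
  refine hBor.inter_mem hreg.aleph0_le (A := {y : Baire κ | i < y α})
    (setOf_mem_bor_of_dep hunc hreg hpow δ _ fun y y' h => by rw [h α hδ])
    (setOf_mem_bor hunc hreg hpow α _ (fun y => hBor.sep_const_mem _ fun hne => ?_) ?_)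
  · refine branchesOf_mem_bor hunc hreg hpow hW hs h3 (hW.mem_of_nonempty hreg.aleph0_le hτ
      (fun U hU => subset_generatedAlgebra _ hU) _ _ ?_)
    rwa [hW.remaining_update]
  · intro y y' h
    simp only [hW.remaining_congr h, hW.update_congr h]

end Borel

end IsScheme

open IsScheme in
/-- A space in which player II wins the fair game is isomorphic to the set of codes of its points
for a shrinking scheme. -/
theorem isStandard_of_isFSC {κ : Cardinal.{u}} (hunc : ℵ₀ < κ) (hreg : κ.IsRegular)
    (hpow : (2 : Cardinal.{u}) ^< κ = κ) {X : Type u} {τ : TopologicalSpace X}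
    (h : IsFSC κ τ) : IsStandard κ (Bor κ τ) := by
  have hBor : IsKappaAlgebra κ (Bor κ (boundedTopology κ)) := isKappaAlgebra_generatedAlgebra _
  have hB : IsKappaAlgebra κ (Bor κ τ) := isKappaAlgebra_generatedAlgebra _
  have hκ := hreg.aleph0_le
  rcases isEmpty_or_nonempty X with hX | hX
  · refine ⟨∅, hBor.empty_mem, Equiv.equivOfIsEmpty _ _, fun A _ => ?_, fun A _ => ?_⟩
    · rw [Set.eq_empty_of_isEmpty (_ ⁻¹' A)]
      exact hB.empty_mem
    · exact ⟨∅, hBor.empty_mem, Subsingleton.elim _ _⟩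
  obtain ⟨O, W, hW, hs⟩ := exists_shrinks hκ h
  choose Φ hΦ using exists_isCode hκ hW
  have hmem : ∀ x α, x ∈ W (Φ x) α := fun x α => (hΦ x α).1
  let D : Set (Baire κ) := {y | ∃ x, ∀ α, IsCode W x y α}
  have hDΦ : ∀ y x, (∀ α, IsCode W x y α) → Φ x = y := fun y x hy => by
    funext α
    obtain ⟨δ, hδ⟩ := (noMaxOrder_toType hκ).exists_gt α
    exact hW.eq_of_isCode (fun β _ => hΦ x β) (fun β _ => hy β) α hδ
  have hbij : Function.Bijective (fun x => (⟨Φ x, x, hΦ x⟩ : D)) := by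
    constructor
    · intro x x' hxx'
      have : Φ x = Φ x' := congrArg Subtype.val hxx'
      exact hs.eq h.t3Space (hmem x) (this ▸ hmem x')
    · rintro ⟨y, x, hx⟩
      exact ⟨x, Subtype.ext (hDΦ y x hx)⟩
  refine ⟨D, codes_mem_bor hunc hreg hpow hW hs h.t3Space, Equiv.ofBijective _ hbij, ?_, ?_⟩
  · rintro _ ⟨S, hS, rfl⟩
    change Φ ⁻¹' S ∈ Bor κ τ
    suffices Bor κ (boundedTopology κ) ⊆ {S | Φ ⁻¹' S ∈ Bor κ τ} from this hS
    have hcyl : ∀ (α : κ.ord.ToType) (y : Baire κ), {x | ∀ β < α, Φ x β = y β} ∈ Bor κ τ := by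
      intro α y
      have : {x | ∀ β < α, Φ x β = y β} = ⋂ β ∈ Set.Iio α, {x | IsCode W x y β} := by
        ext x
        simp only [Set.mem_ofPred_eq, Set.mem_iInter, Set.mem_Iio]
        constructor
        · intro hx β hβ
          have hlt : ∀ γ < β, Φ x γ = y γ := fun γ hγ => hx γ (hγ.trans hβ)
          have := hΦ x β
          refine ⟨?_, fun i hi => ?_⟩
          · rw [← hW.congr β (Φ x) y fun γ hγ => hx γ (hγ.trans_lt hβ)]
            exact this.1
          · rw [← hW.update_congr hlt]
            exact this.2 i (hx β hβ ▸ hi)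
        · exact fun hx => hW.eq_of_isCode (fun β _ => hΦ x β) hx
      by_cases hne : (remaining W y α).Nonempty
      · rw [this]
        refine hB.biInter_mem (mk_Iio_le α) fun β hβ => ?_
        have hne' := hne.mono (remaining_anti y (le_of_lt hβ))
        have hτ : ∀ U, IsOpen[τ] U → U ∈ Bor κ τ := fun U hU => subset_generatedAlgebra _ hU
        have : {x | IsCode W x y β} =
            W y β \ ⋃ i ∈ Set.Iio (y β), W (Function.update y β i) β := by
          ext x
          simp [IsCode]
        rw [this]
        refine hB.diff_mem hκ (hW.mem_of_nonempty hκ hB hτ y β hne') (hB.biUnion_mem (mk_Iio_le _)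
          fun i _ => hW.mem_of_nonempty hκ hB hτ _ β ?_)
        rwa [hW.remaining_update]
      · convert hB.empty_mem
        rw [this, Set.eq_empty_iff_forall_notMem]
        intro x hx
        rw [Set.mem_iInter₂] at hx
        exact hne ⟨x, Set.mem_iInter₂.2 fun β hβ => (hx β hβ).1⟩
    rw [bor_boundedTopology hunc hreg hpow]
    refine coordAlgebra_subset (hB.preimage Φ) fun ζ k => ?_
    obtain ⟨δ, hδ⟩ := (noMaxOrder_toType hκ).exists_gt ζ
    have := setOf_mem_of_agree hunc hreg hpow hB Φ δ (hcyl δ)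
      (fun y => {x | y ζ = k ∧ x ∈ Set.univ})
      (fun y => hB.sep_const_mem _ fun _ => hB.univ_mem)
      (fun y y' h => by simp only [h ζ hδ])
    simpa using this
  · intro A hA
    refine ⟨branchesOf W A, branchesOf_mem_bor hunc hreg hpow hW hs h.t3Space hA, ?_⟩
    ext ⟨y, x, hx⟩
    have hsymm : (Equiv.ofBijective _ hbij).symm ⟨y, x, hx⟩ = x :=
      (Equiv.symm_apply_eq _).2 (Subtype.ext (hDΦ y x hx).symm)
    have hx' : ∀ α, x ∈ W y α := fun α => (hx α).1
    rw [Set.mem_preimage, hsymm]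
    constructor
    · exact fun hxA => ⟨mem_branches hx', x, hxA, hx'⟩
    · rintro ⟨-, z, hzA, hz⟩
      exact hs.eq h.t3Space hx' hz ▸ hzA

/-! ### Standard spaces as closed sets -/

section Presentation

variable {κ : Cardinal.{u}}

/-- The set `A` is decided by one coordinate of a `κ`-Borel map `w` into a power of `κ`, which
records the argument among its other coordinates and has a closed range (for the product of the
discrete topologies). -/
def IsPresentable (A : Set (Baire κ)) : Prop :=
  ∃ (J : Type u) (w : Baire κ → J → κ.ord.ToType) (e : κ.ord.ToType → J) (j₀ : J)
    (Q : Set κ.ord.ToType), #J ≤ κ ∧ (∀ x ζ, w x (e ζ) = x ζ) ∧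
    (∀ u : J → κ.ord.ToType, (∀ S : Set J, S.Finite → ∃ x, ∀ j ∈ S, w x j = u j) →
      ∃ x, w x = u) ∧
    (∀ j k, {x | w x j = k} ∈ coordAlgebra (id : Baire κ → Baire κ)) ∧
    ∀ x, x ∈ A ↔ w x j₀ ∈ Q

theorem isPresentable_coord (ζ k : κ.ord.ToType) :
    IsPresentable {x : Baire κ | x ζ = k} :=
  ⟨κ.ord.ToType, id, id, ζ, {k}, (mk_ord_toType κ).le, fun _ _ => rfl, fun u _ => ⟨u, rfl⟩,
    coord_mem_coordAlgebra _, fun _ => Iff.rfl⟩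

theorem IsPresentable.compl {A : Set (Baire κ)} (hA : IsPresentable A) : IsPresentable Aᶜ := by
  obtain ⟨J, w, e, j₀, Q, hJ, he, hcl, hw, hQ⟩ := hA
  exact ⟨J, w, e, j₀, Qᶜ, hJ, he, hcl, hw, fun x => (hQ x).not⟩

theorem IsPresentable.mem_coordAlgebra {A : Set (Baire κ)} (hA : IsPresentable A) :
    A ∈ coordAlgebra (id : Baire κ → Baire κ) := by
  obtain ⟨J, w, e, j₀, Q, hJ, he, hcl, hw, hQ⟩ := hA
  have : A = ⋃ k ∈ Q, {x | w x j₀ = k} := by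
    ext x
    simp [hQ]
  rw [this]
  exact (isKappaAlgebra_coordAlgebra _).biUnion_mem ((mk_set_le _).trans (mk_ord_toType κ).le)
    fun k _ => hw _ _

/-- The first member of a family which contains a given point, with respect to an enumeration
`c` of the family. -/
theorem exists_first {Y : Type u} {C : Set (Set Y)} (c : Option C → κ.ord.ToType) :
    ∃ m : Y → Option C, (∀ x, m x = none ↔ ∀ A ∈ C, x ∉ A) ∧
      ∀ x (A : C), m x = some A →
        x ∈ (A : Set Y) ∧ ∀ A' : C, c (some A') < c (some A) → x ∉ (A' : Set Y) := by
  have : ∀ x : Y, ∃ o : Option C, (o = none ↔ ∀ A ∈ C, x ∉ A) ∧ ∀ A : C, o = some A →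
      x ∈ (A : Set Y) ∧ ∀ A' : C, c (some A') < c (some A) → x ∉ (A' : Set Y) := fun x => by
    by_cases h : ∃ A : C, x ∈ (A : Set Y)
    · obtain ⟨A, hA, hmin⟩ := (InvImage.wf (fun A : C => c (some A)) wellFounded_lt).has_min
        {A : C | x ∈ (A : Set Y)} h
      refine ⟨some A, ⟨fun h => by simp at h, fun h => (h A A.2 hA).elim⟩, ?_⟩
      rintro A' hA'
      obtain rfl := Option.some.inj hA'
      exact ⟨hA, fun A' h1 h2 => hmin A' h2 h1⟩
    · push Not at h
      exact ⟨none, ⟨fun _ A hA => h ⟨A, hA⟩, fun _ => rfl⟩, fun A hA => by simp at hA⟩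
  choose m hm using this
  exact ⟨m, fun x => (hm x).1, fun x => (hm x).2⟩

/-- To present a union, record presentations of all members together with (the number of) the
first member that contains the given point. -/
theorem isPresentable_sUnion (hκ : ℵ₀ ≤ κ) {C : Set (Set (Baire κ))} (hC : #C ≤ κ)
    (h : ∀ A ∈ C, IsPresentable A) : IsPresentable (⋃₀ C) := by
  have hAlg := isKappaAlgebra_coordAlgebra (id : Baire κ → Baire κ)
  have hmem : ∀ A : C, (A : Set (Baire κ)) ∈ coordAlgebra (id : Baire κ → Baire κ) :=
    fun A => (h A A.2).mem_coordAlgebra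
  have h' : ∀ A : C, IsPresentable (A : Set (Baire κ)) := fun A => h A A.2
  choose J w e j Q hJ he hcl hw hQ using h'
  have hcard : #(Option C) ≤ #κ.ord.ToType := by
    rw [mk_option, mk_ord_toType]
    exact add_le_of_le hκ hC (one_le_aleph0.trans hκ)
  obtain ⟨c⟩ := hcard
  have hc := c.injective
  obtain ⟨m, hm0, hm1⟩ := exists_first c
  -- The value of `m` at a point is determined by the membership of this point in two sets.
  have hm : ∀ x x', (∀ A : C, m x = some A ∨ m x' = some A →
      (x ∈ (A : Set (Baire κ)) ↔ x' ∈ (A : Set (Baire κ)))) → m x = m x' := by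
    intro x x' hA
    rcases hx : m x with _ | A <;> rcases hx' : m x' with _ | A'
    · rfl
    · exact ((hm0 x).1 hx A' A'.2 ((hA A' (Or.inr hx')).2 (hm1 x' A' hx').1)).elim
    · exact ((hm0 x').1 hx' A A.2 ((hA A (Or.inl hx)).1 (hm1 x A hx).1)).elim
    · rcases lt_trichotomy (c (some A)) (c (some A')) with hlt | heq | hlt
      · exact ((hm1 x' A' hx').2 A hlt ((hA A (Or.inl hx)).1 (hm1 x A hx).1)).elim
      · exact hc heq
      · exact ((hm1 x A hx).2 A' hlt ((hA A' (Or.inr hx')).2 (hm1 x' A' hx').1)).elim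
  let w' : Baire κ → κ.ord.ToType ⊕ Option (Σ A : C, J A) → κ.ord.ToType := fun x =>
    Sum.elim x fun o => o.elim (c (m x)) fun t => w t.1 x t.2
  refine ⟨κ.ord.ToType ⊕ Option (Σ A : C, J A), w', Sum.inl, Sum.inr none,
    {k | ∃ A : C, k = c (some A)}, ?_, fun x ζ => rfl, fun u hu => ?_, ?_, fun x => ?_⟩
  · rw [mk_sum, lift_id, lift_id, mk_ord_toType, mk_option, mk_sigma]
    refine add_le_of_le hκ le_rfl (add_le_of_le hκ ?_ (one_le_aleph0.trans hκ))
    refine (sum_le_sum _ (fun _ => κ) hJ).trans ?_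
    rw [sum_const, lift_id, lift_id]
    exact (mul_le_mul_left hC κ).trans (mul_eq_self hκ).le
  · let x₀ : Baire κ := fun ζ => u (Sum.inl ζ)
    -- The coordinates coming from `A` describe a point because the range for `A` is closed. This
    -- point is `x₀` since it is recorded among these coordinates as well.
    have h1 : ∀ A i, w A x₀ i = u (Sum.inr (some ⟨A, i⟩)) := by
      intro A i
      obtain ⟨x, hx⟩ := hcl A (fun i => u (Sum.inr (some ⟨A, i⟩))) fun S hS => by
        obtain ⟨x, hx⟩ := hu ((fun i => Sum.inr (some ⟨A, i⟩)) '' S) (hS.image _)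
        exact ⟨x, fun i hi => hx _ ⟨i, hi, rfl⟩⟩
      have : x = x₀ := by
        funext ζ
        obtain ⟨z, hz⟩ := hu {Sum.inl ζ, Sum.inr (some ⟨A, e A ζ⟩)} (Set.toFinite _)
        have hz1 : z ζ = x₀ ζ := hz _ (Or.inl rfl)
        have hz2 : w A z (e A ζ) = u (Sum.inr (some ⟨A, e A ζ⟩)) := hz _ (Or.inr rfl)
        rw [← hz1, ← he A z ζ, hz2, ← he A x ζ, hx]
      rw [← this, hx]
    have h2 : c (m x₀) = u (Sum.inr none) := by
      let t : Option C → κ.ord.ToType ⊕ Option (Σ A : C, J A) := fun o =>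
        o.elim (Sum.inr none) fun A => Sum.inr (some ⟨A, j A⟩)
      obtain ⟨x₁, hx₁⟩ := hu {Sum.inr none} (Set.toFinite _)
      have hx₁' : c (m x₁) = u (Sum.inr none) := hx₁ _ rfl
      obtain ⟨x, hx⟩ := hu {Sum.inr none, t (m x₁), t (m x₀)} (Set.toFinite _)
      have hx' : c (m x) = u (Sum.inr none) := hx _ (Or.inl rfl)
      have hxx₁ : m x = m x₁ := hc (hx'.trans hx₁'.symm)
      rw [← hx', hm x x₀]
      intro A hA
      have : w A x (j A) = u (Sum.inr (some ⟨A, j A⟩)) := by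
        rcases hA with hA | hA
        · have := hx (t (m x₁)) (Or.inr (Or.inl rfl))
          rw [← hxx₁, hA] at this
          exact this
        · have := hx (t (m x₀)) (Or.inr (Or.inr rfl))
          rw [hA] at this
          exact this
      rw [hQ, hQ, this, h1]
    refine ⟨x₀, ?_⟩
    funext i
    rcases i with ζ | _ | ⟨A, i⟩
    · rfl
    · exact h2
    · exact h1 A i
  · have hm' : ∀ o, {x | m x = o} ∈ coordAlgebra (id : Baire κ → Baire κ) := by
      have hU : ⋃₀ C ∈ coordAlgebra (id : Baire κ → Baire κ) :=
        hAlg.sUnion_mem C (fun A hA => hmem ⟨A, hA⟩) hC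
      rintro (_ | A)
      · have : {x | m x = none} = (⋃₀ C)ᶜ := by
          ext x
          simp [hm0]
        rw [this]
        exact hAlg.compl_mem _ hU
      · have : {x | m x = some A} = A.1 \ ⋃ A' ∈ {A' : C | c (some A') < c (some A)}, A'.1 := by
          ext x
          simp only [Set.mem_ofPred_eq, Set.mem_sdiff, Set.mem_iUnion, not_exists]
          constructor
          · exact fun hx => hm1 x A hx
          · rintro ⟨h1, h2⟩
            rcases hx : m x with _ | A'
            · exact ((hm0 x).1 hx A A.2 h1).elim
            · obtain ⟨h3, h4⟩ := hm1 x A' hx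
              rcases lt_trichotomy (c (some A)) (c (some A')) with hlt | heq | hlt
              · exact (h4 A hlt h1).elim
              · exact (hc heq).symm
              · exact (h2 A' hlt h3).elim
        rw [this]
        exact hAlg.diff_mem hκ (hmem A)
          (hAlg.biUnion_mem ((mk_set_le _).trans hC) fun A' _ => hmem A')
    rintro (ζ | _ | ⟨A, i⟩) k
    · exact coord_mem_coordAlgebra _ ζ k
    · have : {x | w' x (Sum.inr none) = k} = ⋃ o ∈ {o | c o = k}, {x | m x = o} := by
        ext x
        simp [w']
      rw [this]
      refine hAlg.biUnion_mem ?_ fun o _ => hm' o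
      exact ((mk_set_le _).trans (mk_le_of_injective hc)).trans (mk_ord_toType κ).le
    · exact hw A i k
  · change _ ↔ ∃ A, c (m x) = c (some A)
    constructor
    · rintro ⟨A, hA, hxA⟩
      rcases hx : m x with _ | A'
      · exact ((hm0 x).1 hx A hA hxA).elim
      · exact ⟨A', rfl⟩
    · rintro ⟨A, hA⟩
      exact ⟨A, A.2, (hm1 x A (hc hA)).1⟩

theorem isPresentable_of_mem_bor (hunc : ℵ₀ < κ) (hreg : κ.IsRegular)
    (hpow : (2 : Cardinal.{u}) ^< κ = κ) {A : Set (Baire κ)}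
    (hA : A ∈ Bor κ (boundedTopology κ)) : IsPresentable A := by
  rw [bor_boundedTopology hunc hreg hpow] at hA
  refine generatedAlgebra_subset (B := {A | IsPresentable A})
    ⟨fun A hA => hA.compl, fun C hC hκ => isPresentable_sUnion hreg.aleph0_le hκ hC⟩ ?_ hA
  rintro _ ⟨ζ, k, rfl⟩
  exact isPresentable_coord ζ k

/-- A standard space is isomorphic to a closed subset of the Baire space. -/
theorem IsStandard.exists_closed_embedding (hunc : ℵ₀ < κ) (hreg : κ.IsRegular)
    (hpow : (2 : Cardinal.{u}) ^< κ = κ) {X : Type u} {B : Set (Set X)}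
    (hB : IsKappaAlgebra κ B) (h : IsStandard κ B) :
    ∃ Φ : X → Baire κ, Function.Injective Φ ∧
      (∀ z : Baire κ, (∀ ζ, ∃ x, ∀ ξ ≤ ζ, Φ x ξ = z ξ) → ∃ x, Φ x = z) ∧
      coordAlgebra Φ = B := by
  obtain ⟨D, hD, f, hf, hf'⟩ := h
  obtain ⟨J, w, e, j₀, Q, hJ, he, hcl, hw, hQ⟩ := isPresentable_of_mem_bor hunc hreg hpow hD
  have hcard : #J ≤ #κ.ord.ToType := hJ.trans (mk_ord_toType κ).ge
  have : Nonempty J := ⟨j₀⟩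
  obtain ⟨r⟩ := hcard
  let s : κ.ord.ToType → J := Function.invFun r
  have hs : ∀ i, s (r i) = i := Function.leftInverse_invFun r.injective
  have he' : ∀ (x : X) ζ, w (f x) (s (r (e ζ))) = (f x : Baire κ) ζ := fun x ζ => by
    rw [hs, he]
  refine ⟨fun x ζ => w (f x) (s ζ), fun x x' hx => ?_, fun z hz => ?_, ?_⟩
  · refine f.injective (Subtype.ext (funext fun ζ => ?_))
    rw [← he' x, ← he' x']
    exact congrFun hx _
  · have hfin : ∀ S : Set J, S.Finite → ∃ x : X, ∀ i ∈ S, w (f x) i = z (r i) := fun S hS => by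
      have : Nonempty κ.ord.ToType := toType_nonempty hreg.aleph0_le
      obtain ⟨δ, hδ⟩ := (hS.image r).bddAbove
      obtain ⟨x, hx⟩ := hz δ
      refine ⟨x, fun i hi => ?_⟩
      have : w (f x) (s (r i)) = z (r i) := hx (r i) (hδ ⟨i, hi, rfl⟩)
      rwa [hs] at this
    obtain ⟨y, hy⟩ := hcl (fun i => z (r i)) fun S hS => by
      obtain ⟨x, hx⟩ := hfin S hS
      exact ⟨f x, hx⟩
    have hyD : y ∈ D := by
      obtain ⟨x, hx⟩ := hfin {j₀} (Set.finite_singleton _)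
      have hxQ := (hQ _).1 (f x).2
      rw [hx j₀ rfl] at hxQ
      rwa [hQ, hy]
    refine ⟨f.symm ⟨y, hyD⟩, funext fun ζ => ?_⟩
    obtain ⟨x, hx⟩ := hz (max ζ (r (s ζ)))
    simp only [Equiv.apply_symm_apply, hy, ← hx ζ (le_max_left _ _),
      ← hx _ (le_max_right _ _), hs]
  · refine Set.Subset.antisymm (coordAlgebra_subset hB fun ζ k => ?_) fun A hA => ?_
    · refine hf (Subtype.val ⁻¹' {x | w x (s ζ) = k}) ⟨_, ?_, rfl⟩
      rw [bor_boundedTopology hunc hreg hpow]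
      exact hw _ _
    · obtain ⟨S, hS, hAS⟩ := hf' A hA
      have hA' : A = (fun x => (f x : Baire κ)) ⁻¹' S := by
        ext x
        have := Set.ext_iff.1 hAS (f x)
        simpa using this
      rw [hA']
      rw [bor_boundedTopology hunc hreg hpow] at hS
      refine coordAlgebra_subset ((isKappaAlgebra_coordAlgebra _).preimage
        fun x => (f x : Baire κ)) (fun ζ k => ?_) hS
      have := coord_mem_coordAlgebra (fun (x : X) ζ => w (f x) (s ζ)) (r (e ζ)) k
      simp only [he'] at this
      exact this

end Presentation

/-! ### Superclosed sets -/

section Superclosed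

variable {κ : Cardinal.{u}}

/-- A subset of the Baire space is superclosed if it contains a continuation of every sequence, of
any length up to `κ`, whose proper initial segments have continuations in it. Lengths are encoded
by initial segments `I` of `κ`. -/
def IsSuperclosed (Y : Set (Baire κ)) : Prop :=
  Y.Nonempty → ∀ I : Set κ.ord.ToType, IsLowerSet I → ∀ z : Baire κ,
    (∀ ζ ∈ I, ∃ x ∈ Y, ∀ ξ ≤ ζ, x ξ = z ξ) → ∃ x ∈ Y, ∀ ξ ∈ I, x ξ = z ξ

/-- The initial segment of those `ζ` such that the restriction of `z` to the indices up to and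
including `ζ` has a continuation in `C`. -/
def realized (C : Set (Baire κ)) (z : Baire κ) : Set κ.ord.ToType :=
  {ζ | ∃ x ∈ C, ∀ ξ ≤ ζ, x ξ = z ξ}

theorem isLowerSet_realized (C : Set (Baire κ)) (z : Baire κ) : IsLowerSet (realized C z) :=
  fun _ _ hζ ⟨x, hx, h⟩ => ⟨x, hx, fun ξ hξ => h ξ (hξ.trans hζ)⟩

/-- `C` together with one continuation, by the constant value `a`, of each sequence that prevents
`C` from being superclosed. -/
def hull (a : κ.ord.ToType) (C : Set (Baire κ)) : Set (Baire κ) :=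
  C ∪ {z | (¬∃ x ∈ C, ∀ ξ ∈ realized C z, x ξ = z ξ) ∧ ∀ ξ ∉ realized C z, z ξ = a}

theorem isSuperclosed_hull (a : κ.ord.ToType) (C : Set (Baire κ)) :
    IsSuperclosed (hull a C) := by
  classical
  intro hne I hI z hz
  by_cases hC : ∃ ζ ∈ I, ζ ∉ realized C z
  · -- Beyond `ζ`, all members of the hull that continue `z` up to `ζ` are constant.
    obtain ⟨ζ, hζI, hζ⟩ := hC
    have key : ∀ ξ, ζ ≤ ξ → ∀ x ∈ hull a C, (∀ η ≤ ξ, x η = z η) → ∀ η, ζ ≤ η → x η = a := by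
      intro ξ hξ x hx hxz η hη
      have hζx : ζ ∉ realized C x := fun ⟨y, hy, hyx⟩ =>
        hζ ⟨y, hy, fun θ hθ => (hyx θ hθ).trans (hxz θ (hθ.trans hξ))⟩
      rcases hx with hx | ⟨-, hx⟩
      · exact (hζx ⟨x, hx, fun _ _ => rfl⟩).elim
      · exact hx η fun h => hζx (isLowerSet_realized C x hη h)
    obtain ⟨x, hx, hxz⟩ := hz ζ hζI
    refine ⟨x, hx, fun ξ hξ => ?_⟩
    rcases le_total ξ ζ with h | h
    · exact hxz ξ h
    · obtain ⟨x', hx', hxz'⟩ := hz ξ hξ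
      rw [key ζ le_rfl x hx hxz ξ h, ← hxz' ξ le_rfl, key ξ h x' hx' hxz' ξ h]
  · push Not at hC
    by_cases h : ∃ x ∈ C, ∀ ξ ∈ I, x ξ = z ξ
    · obtain ⟨x, hx, hxz⟩ := h
      exact ⟨x, Or.inl hx, hxz⟩
    · let z' : Baire κ := fun ξ => if ξ ∈ I then z ξ else a
      have hz' : ∀ ξ ∈ I, z' ξ = z ξ := fun ξ hξ => if_pos hξ
      have hr : realized C z' = I := by
        ext ζ
        constructor
        · rintro ⟨x, hx, hxz⟩
          by_contra hζ
          refine h ⟨x, hx, fun ξ hξ => ?_⟩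
          have hξζ : ξ ≤ ζ := by
            by_contra hlt
            exact hζ (hI (not_le.1 hlt).le hξ)
          rw [hxz ξ hξζ, hz' ξ hξ]
        · intro hζ
          obtain ⟨x, hx, hxz⟩ := hC ζ hζ
          exact ⟨x, hx, fun ξ hξ => (hxz ξ hξ).trans (hz' ξ (hI hξ hζ)).symm⟩
      refine ⟨z', Or.inr ⟨?_, fun ξ hξ => ?_⟩, hz'⟩
      · rintro ⟨x, hx, hxz⟩
        rw [hr] at hxz
        exact h ⟨x, hx, fun ξ hξ => (hxz ξ hξ).trans (hz' ξ hξ)⟩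
      · rw [hr] at hξ
        exact if_neg hξ

theorem mk_hull_diff_le (hunc : ℵ₀ < κ) (hreg : κ.IsRegular)
    (hpow : (2 : Cardinal.{u}) ^< κ = κ) (a : κ.ord.ToType) {C : Set (Baire κ)}
    (hC : ∀ z, realized C z = Set.univ → z ∈ C) : #(hull a C \ C : Set (Baire κ)) ≤ κ := by
  have hsub : hull a C \ C ⊆ Set.range
      fun t : Σ α : κ.ord.ToType, (Set.Iio α → κ.ord.ToType) => extendSeq a t.1 t.2 := by
    rintro z ⟨hz | ⟨-, hz⟩, hzC⟩
    · exact (hzC hz).elim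
    · obtain ⟨ζ, hζ⟩ := (Set.ne_univ_iff_exists_notMem _).1 (mt (hC z) hzC)
      refine ⟨⟨ζ, fun ξ => z ξ⟩, funext fun ξ => ?_⟩
      by_cases h : ξ < ζ
      · exact extendSeq_of_lt a (fun ξ : Set.Iio ζ => z ξ) h
      · rw [hz ξ fun h' => hζ (isLowerSet_realized C z (not_lt.1 h) h')]
        simp [extendSeq, h]
  exact (mk_le_mk_of_subset hsub).trans (mk_range_le.trans (mk_sigma_seq_le hunc hreg hpow))

/-- A set with at least `κ` many points absorbs `κ` many further points, by a bijection that moves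
only `κ` many points. -/
theorem exists_equiv_sum {X E : Type u} (hκ : ℵ₀ ≤ κ) (hX : κ ≤ #X) (hE : #E ≤ κ) :
    ∃ (Z : Set X) (G : X ≃ X ⊕ E), #Z ≤ κ ∧ ∀ x ∉ Z, G x = Sum.inl x := by
  classical
  obtain ⟨Z, hZ⟩ := le_mk_iff_exists_set.1 hX
  have hg : #Z = #(Z ⊕ E) := by
    rw [mk_sum, lift_id, lift_id, hZ, add_eq_left hκ hE]
  obtain ⟨g⟩ := Cardinal.eq.1 hg
  refine ⟨Z, (Equiv.Set.sumCompl Z).symm.trans <|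
    (Equiv.sumCongr g (Equiv.refl _)).trans <| (Equiv.sumAssoc _ _ _).trans <|
    (Equiv.sumCongr (Equiv.refl _) (Equiv.sumComm _ _)).trans <|
    (Equiv.sumAssoc _ _ _).symm.trans <|
    Equiv.sumCongr (Equiv.Set.sumCompl Z) (Equiv.refl _), hZ.le, fun x hx => ?_⟩
  simp [Equiv.Set.sumCompl_symm_apply_of_notMem hx]

/-- The algebra of a closed subset of the Baire space is also the one of a superclosed set: the
points that have to be added can be absorbed, unless the set has at most `κ` many points, in
which case the algebra consists of all subsets. -/
theorem exists_superclosed_embedding (hunc : ℵ₀ < κ) (hreg : κ.IsRegular)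
    (hpow : (2 : Cardinal.{u}) ^< κ = κ) {X : Type u} {Φ : X → Baire κ}
    (hΦ : Function.Injective Φ)
    (hcl : ∀ z : Baire κ, (∀ ζ, ∃ x, ∀ ξ ≤ ζ, Φ x ξ = z ξ) → ∃ x, Φ x = z) :
    ∃ Ψ : X → Baire κ, Function.Injective Ψ ∧ IsSuperclosed (Set.range Ψ) ∧
      coordAlgebra Ψ = coordAlgebra Φ := by
  obtain ⟨a⟩ := toType_nonempty hreg.aleph0_le
  rcases le_total #X κ with hX | hX
  · obtain ⟨e⟩ : #X ≤ #κ.ord.ToType := hX.trans (mk_ord_toType κ).ge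
    have hΨ : Function.Injective fun x (_ : κ.ord.ToType) => e x := fun x x' h =>
      e.injective (congrFun h a)
    refine ⟨fun x _ => e x, hΨ, fun hne I hI z hz => ?_, ?_⟩
    · rcases I.eq_empty_or_nonempty with rfl | ⟨ζ, hζ⟩
      · obtain ⟨y, hy⟩ := hne
        exact ⟨y, hy, fun ξ hξ => hξ.elim⟩
      · obtain ⟨_, ⟨x, rfl⟩, hx⟩ := hz ζ hζ
        refine ⟨_, ⟨x, rfl⟩, fun ξ hξ => ?_⟩
        rcases le_total ξ ζ with h | h
        · exact hx ξ h
        · obtain ⟨_, ⟨x', rfl⟩, hx'⟩ := hz ξ hξ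
          exact (hx ζ le_rfl).trans ((hx' ζ h).symm.trans (hx' ξ le_rfl))
    · exact coordAlgebra_eq_of_eqOn_compl hreg.aleph0_le hΨ hΦ (Z := Set.univ)
        ((mk_set_le _).trans hX) (by simp)
  · -- `Ψ` is a bijection onto the hull which agrees with `Φ` outside the set `Z` of size `κ`.
    obtain ⟨Z, G, hZ, hG⟩ := exists_equiv_sum hreg.aleph0_le hX
      (mk_hull_diff_le hunc hreg hpow a (C := Set.range Φ) fun z hz => hcl z fun ζ => by
        obtain ⟨_, ⟨x, rfl⟩, hx⟩ : ζ ∈ realized (Set.range Φ) z := hz ▸ trivial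
        exact ⟨x, hx⟩)
    have hinj : Function.Injective (Sum.elim Φ Subtype.val ∘ G) :=
      (hΦ.sumElim Subtype.val_injective fun x e h => e.2.2 ⟨x, h⟩).comp G.injective
    refine ⟨_, hinj, ?_, coordAlgebra_eq_of_eqOn_compl hreg.aleph0_le hinj hΦ hZ fun x hx => ?_⟩
    · rw [Set.range_comp, G.surjective.range_eq, Set.image_univ, Set.Sum.elim_range,
        Subtype.range_coe,
        Set.union_sdiff_cancel (show Set.range Φ ⊆ hull a (Set.range Φ) from
          fun _ => Or.inl)]
      exact isSuperclosed_hull a _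
    · simp [hG x hx]

end Superclosed

/-! ### The topology of a superclosed set -/

section InducedTopology

variable {κ : Cardinal.{u}} {X : Type u}

theorem isOpen_induced_agree (Ψ : X → Baire κ) (α : κ.ord.ToType) (y : Baire κ) :
    IsOpen[.induced Ψ (boundedTopology κ)] {x | ∀ β < α, Ψ x β = y β} := by
  let _ := boundedTopology κ
  exact isOpen_induced (f := Ψ) (isOpen_agree α y)

theorem isAdditive_induced (hreg : κ.IsRegular) (Ψ : X → Baire κ) :
    IsAdditive κ (.induced Ψ (boundedTopology κ)) := by
  intro C hC hcard
  rw [isOpen_induced_iff_agree hreg.aleph0_le]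
  intro x hx
  have : ∀ U : C, ∃ α : κ.ord.ToType, {x' | ∀ β < α, Ψ x' β = Ψ x β} ⊆ U := fun U =>
    (isOpen_induced_iff_agree hreg.aleph0_le Ψ U).1 (hC U U.2) x (hx U U.2)
  choose δ hδ using this
  obtain ⟨α, hα⟩ := exists_forall_lt_of_mk_lt hreg (S := Set.range δ)
    (mk_range_le.trans_lt hcard)
  exact ⟨α, fun x' hx' U hU =>
    hδ ⟨U, hU⟩ fun β hβ => hx' β (hβ.trans (hα _ ⟨⟨U, hU⟩, rfl⟩))⟩

theorem weightLE_induced (hunc : ℵ₀ < κ) (hreg : κ.IsRegular)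
    (hpow : (2 : Cardinal.{u}) ^< κ = κ) (Ψ : X → Baire κ) :
    WeightLE κ (.induced Ψ (boundedTopology κ)) := by
  obtain ⟨a⟩ := toType_nonempty hreg.aleph0_le
  refine ⟨Set.range fun t : Σ α : κ.ord.ToType, (Set.Iio α → κ.ord.ToType) =>
    {x | ∀ β < t.1, Ψ x β = extendSeq a t.1 t.2 β},
    mk_range_le.trans (mk_sigma_seq_le hunc hreg hpow), ?_⟩
  let _ : TopologicalSpace X := .induced Ψ (boundedTopology κ)
  refine TopologicalSpace.isTopologicalBasis_of_isOpen_of_nhds ?_ fun x U hx hU => ?_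
  · rintro _ ⟨t, rfl⟩
    exact isOpen_induced_agree Ψ _ _
  · obtain ⟨α, hα⟩ := (isOpen_induced_iff_agree hreg.aleph0_le Ψ U).1 hU x hx
    have h : ∀ β < α, extendSeq a α (fun ξ : Set.Iio α => Ψ x ξ) β = Ψ x β := fun β hβ =>
      extendSeq_of_lt a (fun ξ : Set.Iio α => Ψ x ξ) hβ
    exact ⟨_, ⟨⟨α, fun ξ => Ψ x ξ⟩, rfl⟩, fun β hβ => (h β hβ).symm,
      fun x' hx' => hα fun β hβ => (hx' β hβ).trans (h β hβ)⟩

theorem t3Space_induced (hκ : ℵ₀ ≤ κ) {Ψ : X → Baire κ} (hΨ : Function.Injective Ψ) :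
    @T3Space X (.induced Ψ (boundedTopology κ)) := by
  let _ : TopologicalSpace X := .induced Ψ (boundedTopology κ)
  have hopen := isOpen_induced_iff_agree hκ Ψ
  have hreg : RegularSpace X := by
    refine RegularSpace.of_exists_mem_nhds_isClosed_subset fun x s hs => ?_
    obtain ⟨U, hUs, hU, hxU⟩ := mem_nhds_iff.1 hs
    obtain ⟨α, hα⟩ := (hopen U).1 hU x hxU
    refine ⟨{x' | ∀ β < α, Ψ x' β = Ψ x β},
      (isOpen_induced_agree Ψ α (Ψ x)).mem_nhds fun _ _ => rfl, ⟨?_⟩, hα.trans hUs⟩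
    refine (hopen _).2 fun x' hx' => ⟨α, fun x'' hx'' h => hx' fun β hβ => ?_⟩
    exact (hx'' β hβ).symm.trans (h β hβ)
  have hT0 : T0Space X := by
    refine ⟨fun x x' h => hΨ (funext fun ζ => ?_)⟩
    obtain ⟨α, hα⟩ := (noMaxOrder_toType hκ).exists_gt ζ
    have := (h.mem_open_iff (isOpen_induced_agree Ψ α (Ψ x))).1 fun _ _ => rfl
    exact (this ζ hα).symm
  exact {}

/-- In a superclosed set, player II wins by answering with basic open sets: the sequences which
define these sets fit together, and their union has a continuation in the set. -/
theorem exists_winningStrong (hreg : κ.IsRegular) {Ψ : X → Baire κ}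
    (hΨ : IsSuperclosed (Set.range Ψ)) :
    ∃ σ : Strategy κ X, WinningStrong (.induced Ψ (boundedTopology κ)) σ := by
  classical
  obtain ⟨a⟩ := toType_nonempty hreg.aleph0_le
  have hd : ∀ (x : X) (U : Set X), ∃ δ : κ.ord.ToType,
      (∃ δ : κ.ord.ToType, {x' | ∀ β < δ, Ψ x' β = Ψ x β} ⊆ U) →
      {x' | ∀ β < δ, Ψ x' β = Ψ x β} ⊆ U := fun x U => by
    by_cases h : ∃ δ : κ.ord.ToType, {x' | ∀ β < δ, Ψ x' β = Ψ x β} ⊆ U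
    · exact ⟨h.choose, fun _ => h.choose_spec⟩
    · exact ⟨a, fun h' => (h h').elim⟩
  choose d hd using hd
  let τ : TopologicalSpace X := .induced Ψ (boundedTopology κ)
  -- Only the last move of player I matters, and no legality is needed for the answers to be open.
  let σ : Strategy κ X := fun α h =>
    let m := h ⟨α, Set.self_mem_Iic⟩
    {x' | ∀ β < d m.2 m.1, Ψ x' β = Ψ m.2 β}
  have hσ : ∀ p α, reply σ p α = {x' | ∀ β < d (p α).2 (p α).1, Ψ x' β = Ψ (p α).2 β} :=
    fun _ _ => rfl
  have hbefore : ∀ p α, IsOpen[τ] (before σ p α) := fun p α => by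
    have : before σ p α = ⋂₀ ((fun β => reply σ p β) '' Set.Iio α) := by
      simp [before]
    rw [this]
    refine isAdditive_induced hreg Ψ _ ?_ (mk_image_le.trans_lt (mk_Iio_lt α))
    rintro _ ⟨β, -, rfl⟩
    exact isOpen_induced_agree Ψ _ _
  have hsub : ∀ p α, LegalI τ σ p α → reply σ p α ⊆ (p α).1 := fun p α ⟨hx, G, hG, h⟩ => by
    have hU : IsOpen[τ] (p α).1 := h ▸ hG.inter (hbefore p α)
    exact hd _ _ ((isOpen_induced_iff_agree hreg.aleph0_le Ψ _).1 hU _ hx)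
  have hlegal : ∀ p α, (∀ β ≤ α, LegalI τ σ p β) → LegalII τ σ p α := fun p α h => by
    have hs := hsub p α (h α le_rfl)
    obtain ⟨-, G, -, hG⟩ := h α le_rfl
    refine ⟨fun _ _ => rfl, hs, reply σ p α, isOpen_induced_agree Ψ _ _, ?_⟩
    exact (Set.inter_eq_left.2 (hs.trans (hG ▸ Set.inter_subset_right))).symm
  have hwin : ∀ p (J : Set κ.ord.ToType), (∀ β ∈ J, LegalI τ σ p β) →
      ∃ x, ∀ β ∈ J, x ∈ reply σ p β := by
    intro p J hJ
    let δ : κ.ord.ToType → κ.ord.ToType := fun β => d (p β).2 (p β).1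
    have hlt : ∀ β ∈ J, ∀ β' ∈ J, β < β' → ∀ ζ < δ β, Ψ (p β').2 ζ = Ψ (p β).2 ζ := by
      intro β _ β' hβ' h ζ hζ
      obtain ⟨hx, G, -, hG⟩ := hJ β' hβ'
      rw [hG] at hx
      exact Set.mem_iInter₂.1 hx.2 β h ζ hζ
    have hcoh : ∀ β ∈ J, ∀ β' ∈ J, ∀ ζ, ζ < δ β → ζ < δ β' →
        Ψ (p β').2 ζ = Ψ (p β).2 ζ := by
      intro β hβ β' hβ' ζ h h'
      rcases lt_trichotomy β β' with hlt' | rfl | hlt'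
      · exact hlt β hβ β' hβ' hlt' ζ h
      · rfl
      · exact (hlt β' hβ' β hβ hlt' ζ h').symm
    let I : Set κ.ord.ToType := {ζ | ∃ β ∈ J, ζ < δ β}
    -- The union of the sequences defining the answers of player II, continued by `a`.
    let z : Baire κ := fun ζ => if h : ∃ β ∈ J, ζ < δ β then Ψ (p h.choose).2 ζ else a
    have hz : ∀ β ∈ J, ∀ ζ < δ β, z ζ = Ψ (p β).2 ζ := fun β hβ ζ hζ => by
      have h : ∃ β ∈ J, ζ < δ β := ⟨β, hβ, hζ⟩
      simp only [z, dif_pos h]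
      exact hcoh β hβ _ h.choose_spec.1 ζ hζ h.choose_spec.2
    obtain ⟨_, ⟨x, rfl⟩, hx⟩ := hΨ ⟨_, (p a).2, rfl⟩ I
      (fun ζ ζ' h ⟨β, hβ, hζ⟩ => ⟨β, hβ, h.trans_lt hζ⟩) z fun ζ ⟨β, hβ, hζ⟩ =>
      ⟨_, ⟨(p β).2, rfl⟩, fun ξ hξ => (hz β hβ ξ (hξ.trans_lt hζ)).symm⟩
    exact ⟨x, fun β hβ ζ hζ => (hx ζ ⟨β, hβ, hζ⟩).trans (hz β hβ ζ hζ)⟩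
  refine ⟨σ, fun p => ⟨hlegal p, fun γ _ h => ?_, fun h => ?_⟩⟩
  · obtain ⟨x, hx⟩ := hwin p (Set.Iio γ) h
    exact ⟨x, Set.mem_iInter₂.2 hx⟩
  · obtain ⟨x, hx⟩ := hwin p Set.univ fun β _ => h β
    exact ⟨x, Set.mem_iInter.2 fun β => hx β trivial⟩

end InducedTopology

theorem IsStandard.exists_isSC {κ : Cardinal.{u}} (hunc : ℵ₀ < κ) (hreg : κ.IsRegular)
    (hpow : (2 : Cardinal.{u}) ^< κ = κ) {X : Type u} {B : Set (Set X)}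
    (hB : IsKappaAlgebra κ B) (h : IsStandard κ B) :
    ∃ τ : TopologicalSpace X, (IsAdditive κ τ ∧ IsSC κ τ) ∧ Bor κ τ = B := by
  obtain ⟨Φ, hΦ, hcl, rfl⟩ := h.exists_closed_embedding hunc hreg hpow hB
  obtain ⟨Ψ, hΨ, hsc, hΨΦ⟩ := exists_superclosed_embedding hunc hreg hpow hΦ hcl
  exact ⟨.induced Ψ (boundedTopology κ), ⟨isAdditive_induced hreg Ψ,
    t3Space_induced hreg.aleph0_le hΨ, weightLE_induced hunc hreg hpow Ψ,
    exists_winningStrong hreg hsc⟩, (bor_induced hunc hreg hpow Ψ).trans hΨΦ⟩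

theorem IsSC.isFSC {κ : Cardinal.{u}} {X : Type u} {τ : TopologicalSpace X} (h : IsSC κ τ) :
    IsFSC κ τ := by
  obtain ⟨h3, hw, σ, hσ⟩ := h
  exact ⟨h3, hw, σ, fun p => ⟨(hσ p).1, (hσ p).2.2⟩⟩

end GDST

theorem mainTheorem4 (κ : Cardinal.{u}) (hunc : ℵ₀ < κ) (hreg : κ.IsRegular)
    (hpow : (2 : Cardinal.{u}) ^< κ = κ)
    {X : Type u} (B : Set (Set X)) (hB : GDST.IsKappaBorelSpace κ B) :
    (GDST.IsStandard κ B ↔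
      ∃ τ : TopologicalSpace X, GDST.IsFSC κ τ ∧ GDST.Bor κ τ = B) ∧
    (GDST.IsStandard κ B ↔
      ∃ τ : TopologicalSpace X,
        (GDST.IsAdditive κ τ ∧ GDST.IsSC κ τ) ∧ GDST.Bor κ τ = B) := by
  have h12 : (∃ τ : TopologicalSpace X, GDST.IsFSC κ τ ∧ GDST.Bor κ τ = B) →
      GDST.IsStandard κ B := by
    rintro ⟨τ, hτ, rfl⟩
    exact GDST.isStandard_of_isFSC hunc hreg hpow hτ
  have h13 := GDST.IsStandard.exists_isSC hunc hreg hpow hB.isKappaAlgebra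
  refine ⟨⟨fun h => ?_, h12⟩, ⟨h13, ?_⟩⟩
  · obtain ⟨τ, ⟨-, hτ⟩, hτB⟩ := h13 h
    exact ⟨τ, hτ.isFSC, hτB⟩
  · rintro ⟨τ, ⟨-, hτ⟩, hτB⟩
    exact h12 ⟨τ, hτ.isFSC, hτB⟩
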